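/- **Corollary ($p$-Trotterized quantum annealing is stable).** *Conventions.* Operators act on $(\mathbb{C}^2)^{\otimes n}$. A Pauli operator is a tensor product of the matrices $I,X,Y,Z$; it is $d$-local if at most $d$ of its tensor factors differ from $I$. The support of an operator $O$ is the set of qubits $i$ for which $O$ is not of the form $I\otimes O_i$ with $I$ acting on qubit $i$. The interaction hypergraph of a sum $\sum_j A_j$ has the qubits as vertices and the sets $\operatorname{supp}(A_j)$ as hyperedges; its degree is the largest number of hyperedges that contain a common qubit. For a traceless Hermitian $M$, $$\lVert M\rVert_{W_2}=\min\Big\{\sum_{i=1}^n\big\lVert\tfrac12 M_i\big\rVert_*^{1/2}\;:\;M=\sum_{i=1}^n M_i,\ M_i=M_i^\dagger,\ \operatorname{Tr}_{\{i\}}(M_i)=0\Big\}$$ where $\lVert\cdot\rVert_*$ is the trace norm. *Stability.* Let $H_1,\dots,H_D$ be interaction terms, $s\in[0,1]$ a sparsity parameter and $\mathfrak d\in\mathbb N$. Let $S\in\{0,1\}^D$ be i.i.d. Bernoulli with mean $s$, conditioned on the interaction hypergraph of $\sum_j S_jJ_jH_j$ having degree at most $\mathfrak d$, and let $J$ be an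 independent standard Gaussian vector in $\mathbb R^D$. For $\kappa\in[0,1]$ let $\mathbb P^{\mathfrak d,\kappa}$ be any law of a pair $(X,Y)\in\mathbb R^D\times\mathbb R^D$ such that $X$ and $Y$ are each distributed as $S\odot J$ and such that, for some set $\mathcal Q$ of exactly $\kappa n$ qubits, almost surely $X_j=Y_j\iff\operatorname{supp}(H_j)\subseteq\mathcal Q$ for every $j$ with $(X_j,Y_j)\neq(0,0)$. A quantum algorithm, i.e. a map $\mathcal A(X,\omega)$ from $\mathbb R^D\times\Omega$ to $n$-qubit mixed states with $(\Omega,\mathbb P_\Omega)$ a probability space, is $(f,L,\mathfrak d,0,p_{\mathrm{st}})$-stable if for every $\kappa\in[0,1]$ and every such law, $$\lVert\mathcal A(X,\omega)-\mathcal A(Y,\omega)\rVert_{W_2}\le f+L\lVert X-Y\rVert_1$$ with probability at least $1-p_{\mathrm{st}}$ over $((X,Y),\omega)\sim\mathbb P^{\mathfrak d,\kappa}\otimes\mathbb P_\Omega$. *Algorithm.* Let $P_1,\dots,P_D$ be $d$-local Pauli operators and let $[D]=\mathcal I_1\sqcup\dots\sqcup\mathcal I_K$ be a partition, with $Z=\sum_i|\mathcal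 I_i|\ge n$. Put $$H_C^{(i)}(X)=\frac1{\sqrt Z}\sum_{j\in\mathcal I_i}X_jP_j ,$$ and assume that for each fixed $i$ the operators $\{H_C^{(i)}(X)\}_{X\in\mathbb R^D}$ commute with one another. For every $\omega\in\Omega$ let $\psi_0(\omega)$ be a unit vector and let the mixer $H_M(\omega)$ be a sum of mutually commuting Hermitian terms, each supported on at most $d$ qubits, with interaction hypergraph of degree at most $\mathfrak d$. For real parameters $\theta=(\beta_l,\gamma_l^{(i)})_{1\le l\le p,\,1\le i\le K}$, $p$-Trotterized quantum annealing (which covers QAOA and the Hamiltonian variational ansatz) is $\mathcal A_p(X,\omega)=|\psi_p(X,\omega)\rangle\langle\psi_p(X,\omega)|$ with $$|\psi_p(X,\omega)\rangle=\prod_{l=p}^{1}\Big(e^{-\mathrm i\beta_lH_M(\omega)}\prod_{i=K}^{1}e^{-\mathrm i\frac{\gamma_l^{(i)}}{\sqrt n}H_C^{(i)}(X)}\Big)|\psi_0(\omega)\rangle .$$ *Claim.* For the interaction terms $P_1,\dots,P_D$, every sparsity parameter $s\in[0,1]$ and every $\mathfrak d\in\mathbb N$, $\mathcal A_p$ is $(\sqrt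 n,\lambda_p,\mathfrak d,0,0)$-stable, where $$\lambda_p=\frac{\lVert\theta\rVert_\infty}{4\sqrt{2n}}\Big(\frac32\,d\,\mathfrak d\Big)^{(K+1)p}.$$ -/

import Mathlib

open MeasureTheory ProbabilityTheory
open scoped ComplexOrder

noncomputable section

namespace QAnneal

/-! ### Qubits, Pauli operators, states -/

/-- Linear operators on `n` qubits, written in the computational basis. -/
abbrev QOp (n : ℕ) : Type := Matrix (Fin n → Fin 2) (Fin n → Fin 2) ℂ

/-- The four single-qubit Pauli matrices `1, X, Y, Z`. -/
def sigma : Fin 4 → Matrix (Fin 2) (Fin 2) ℂ :=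
  ![!![1, 0; 0, 1], !![0, 1; 1, 0], !![0, -Complex.I; Complex.I, 0], !![1, 0; 0, -1]]

/-- The Pauli operator `σ^(x 0) ⊗ ⋯ ⊗ σ^(x (n-1))`. -/
def pauli {n : ℕ} (x : Fin n → Fin 4) : QOp n :=
  Matrix.of fun a b => ∏ i, sigma (x i) (a i) (b i)

/-- The number of non-identity tensor factors of the Pauli operator labelled by `x`. -/
def pauliWeight {n : ℕ} (x : Fin n → Fin 4) : ℕ :=
  (Finset.univ.filter fun i => x i ≠ 0).card

/-- Mixed states: positive semidefinite operators of unit trace. -/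
def IsMixedState {n : ℕ} (ρ : QOp n) : Prop :=
  ρ.PosSemidef ∧ ρ.trace = 1

/-- `O = 1 ⊗ O'` with the identity acting on qubit `i` and `O'` acting on the other qubits. -/
def ActsTriviallyAt {n : ℕ} (O : QOp n) (i : Fin n) : Prop :=
  ∃ O' : Matrix ({j // j ≠ i} → Fin 2) ({j // j ≠ i} → Fin 2) ℂ,
    ∀ a b, O a b = if a i = b i then O' (fun j => a j) (fun j => b j) else 0

open Classical in
/-- The support of an operator: the qubits at which it does not act trivially. -/
def opSupport {n : ℕ} (O : QOp n) : Finset (Fin n) :=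
  Finset.univ.filter fun i => ¬ ActsTriviallyAt O i

/-! ### Interaction hypergraphs -/

/-- The hyperedges of the interaction hypergraph of `∑ j, A j`: the supports of the terms. -/
def hyperedges {n m : ℕ} (A : Fin m → QOp n) : Finset (Finset (Fin n)) :=
  Finset.univ.image fun j => opSupport (A j)

/-- Every vertex lies in at most `𝔡` hyperedges of the interaction hypergraph of `∑ j, A j`. -/
def DegreeLE {n m : ℕ} (A : Fin m → QOp n) (𝔡 : ℕ) : Prop :=
  ∀ v : Fin n, ((hyperedges A).filter fun e => v ∈ e).card ≤ 𝔡

/-- `H` is a sum of mutually commuting Hermitian terms, each supported on at most `d` qubits, whose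
interaction hypergraph has degree at most `𝔡`. -/
def IsCommutingLocal {n : ℕ} (d 𝔡 : ℕ) (H : QOp n) : Prop :=
  ∃ (m : ℕ) (A : Fin m → QOp n), H = ∑ k, A k ∧
    (∀ k, (A k).IsHermitian) ∧
    (∀ k, (opSupport (A k)).card ≤ d) ∧
    (∀ k l, Commute (A k) (A l)) ∧
    DegreeLE A 𝔡

/-! ### The quantum Wasserstein distance of order `α` -/

/-- The trace norm `Tr √(Aᴴ A)`: the sum of the square roots of the eigenvalues of `Aᴴ A`. -/
def traceNorm {n : ℕ} (A : QOp n) : ℝ :=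
  ∑ a, Real.sqrt ((Matrix.isHermitian_conjTranspose_mul_self A).eigenvalues a)

/-- The basis label of all `n` qubits with value `s` at qubit `i` and the values `a` elsewhere. -/
def glue {n : ℕ} (i : Fin n) (s : Fin 2) (a : {j // j ≠ i} → Fin 2) : Fin n → Fin 2 :=
  fun j => if h : j = i then s else a ⟨j, h⟩

/-- The partial trace over qubit `i`. -/
def partialTrace {n : ℕ} (i : Fin n) (X : QOp n) :
    Matrix ({j // j ≠ i} → Fin 2) ({j // j ≠ i} → Fin 2) ℂ :=
  Matrix.of fun a b => ∑ s : Fin 2, X (glue i s a) (glue i s b)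

/-- The decompositions `X = ∑ i, X_i` into Hermitian operators with `Tr_{i} X_i = 0`. -/
def decompositions {n : ℕ} (X : QOp n) : Set (Fin n → QOp n) :=
  {Y | X = ∑ i, Y i ∧ (∀ i, (Y i).IsHermitian) ∧ ∀ i, partialTrace i (Y i) = 0}

/-- The quantum Wasserstein `F`-norm of order `α` of a traceless Hermitian operator. -/
def wassersteinNorm {n : ℕ} (α : ℝ) (X : QOp n) : ℝ :=
  sInf ((fun Y : Fin n → QOp n => ∑ i, (traceNorm (Y i) / 2) ^ (1 / α)) '' decompositions X)

/-! ### Stable quantum algorithms -/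

/-- The law of `S ⊙ J`: `J` is standard normal and `S` is i.i.d. Bernoulli with parameter `s`,
conditioned on the interaction degree of `∑ j, S_j J_j H_j` being at most `𝔡`. (The event is
written through `S` alone, as all `J_j` are nonzero almost surely.) -/
def sparseDisorder {n D : ℕ} (H : Fin D → QOp n) (s : unitInterval) (𝔡 : ℕ) :
    Measure (Fin D → ℝ) :=
  ((cond (Measure.pi fun _ : Fin D => bernoulliMeasure (1 : ℝ) 0 s)
      {S | DegreeLE (fun j => (S j : ℂ) • H j) 𝔡}).prod
    (Measure.pi fun _ : Fin D => gaussianReal 0 1)).map fun z j => z.1 j * z.2 j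

/-- `μ` is one of the laws of pairs `(X, Y)` of instances at correlation `κ`: both marginals are the
sparse Gaussian disorder, and there is a set `Q` of `κ n` qubits such that the coefficients of
`X` and `Y` agree exactly on the terms supported in `Q`, among the terms that are present. -/
structure IsCorrelatedPair {n D : ℕ} (H : Fin D → QOp n) (s : unitInterval) (𝔡 : ℕ) (κ : ℝ)
    (μ : Measure ((Fin D → ℝ) × (Fin D → ℝ))) : Prop where
  isProbability : IsProbabilityMeasure μ
  map_fst : μ.map Prod.fst = sparseDisorder H s 𝔡
  map_snd : μ.map Prod.snd = sparseDisorder H s 𝔡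
  correlated : ∃ Q : Finset (Fin n), (Q.card : ℝ) = κ * n ∧
    ∀ᵐ z ∂μ, ∀ j, z.1 j ≠ 0 ∨ z.2 j ≠ 0 → (z.1 j = z.2 j ↔ opSupport (H j) ⊆ Q)

/-- The quantum algorithm `A` (a map from inputs and classical randomness to mixed states) is
`(f, L, 𝔡, 𝒦, pst)`-stable for the disordered Hamiltonian with interaction terms `H` and
sparsity parameter `s`. The failure probability is bounded directly, which is the stronger
requirement when the event is not measurable. -/
structure IsStableAlgorithm {Ω : Type*} [MeasurableSpace Ω] (P : Measure Ω) {n D : ℕ}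
    (H : Fin D → QOp n) (s : unitInterval) (A : (Fin D → ℝ) → Ω → QOp n)
    (f L : ℝ) (𝔡 : ℕ) (𝒦 : Set ℝ) (pst : ℝ) : Prop where
  isMixedState : ∀ X ω, IsMixedState (A X ω)
  stable : ∀ κ ∈ 𝒦, ∀ μ : Measure ((Fin D → ℝ) × (Fin D → ℝ)), IsCorrelatedPair H s 𝔡 κ μ →
    (μ.prod P) {z | ¬ wassersteinNorm 2 (A z.1.1 z.2 - A z.1.2 z.2)
      ≤ f + L * ∑ j, |z.1.1 j - z.1.2 j|} ≤ ENNReal.ofReal pst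

/-! ### `p`-Trotterized quantum annealing -/

/-- The index set `I_i` of the `i`-th group of a partition of the cost terms into `K` groups. -/
def costIndex {D K : ℕ} (part : Fin D → Fin K) (i : Fin K) : Finset (Fin D) :=
  Finset.univ.filter fun j => part j = i

/-- The normalization `Z = ∑ i, |I_i|`. -/
def costZ {D K : ℕ} (part : Fin D → Fin K) : ℕ :=
  ∑ i, (costIndex part i).card

/-- The `i`-th cost Hamiltonian `Z^(-1/2) ∑_{j ∈ I_i} X_j P_j`. -/
def costTerm {n D K : ℕ} (x : Fin D → Fin n → Fin 4) (part : Fin D → Fin K) (i : Fin K)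
    (X : Fin D → ℝ) : QOp n :=
  ((1 / Real.sqrt (costZ part) : ℝ) : ℂ) • ∑ j ∈ costIndex part i, (X j : ℂ) • pauli (x j)

/-- `exp (-i t H)`. -/
def evolve {n : ℕ} (t : ℝ) (H : QOp n) : QOp n :=
  NormedSpace.exp ((-Complex.I * (t : ℂ)) • H)

/-- One layer: the cost evolutions in the order `i = 1, …, K`, followed by the mixer. -/
def annealLayer {n K : ℕ} (HC : Fin K → QOp n) (HM : QOp n) (β : ℝ) (γ : Fin K → ℝ) : QOp n :=
  evolve β HM * (List.ofFn fun i => evolve (γ i / Real.sqrt n) (HC i)).reverse.prod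

/-- The whole circuit: the layers `l = 1, …, p`, the first one acting first. -/
def annealCircuit {n K p : ℕ} (HC : Fin K → QOp n) (HM : QOp n)
    (β : Fin p → ℝ) (γ : Fin p → Fin K → ℝ) : QOp n :=
  (List.ofFn fun l => annealLayer HC HM (β l) (γ l)).reverse.prod

/-- The `p`-Trotterized quantum annealing algorithm: the density operator of the circuit's output
on the initial state `ψ₀ ω`. -/
def annealing {Ω : Type*} {n D K p : ℕ} (HC : Fin K → (Fin D → ℝ) → QOp n) (HM : Ω → QOp n)
    (β : Fin p → ℝ) (γ : Fin p → Fin K → ℝ) (ψ₀ : Ω → (Fin n → Fin 2) → ℂ)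
    (X : Fin D → ℝ) (ω : Ω) : QOp n :=
  let ψ := (annealCircuit (fun i => HC i X) (HM ω) β γ).mulVec (ψ₀ ω)
  Matrix.vecMulVec ψ (star ψ)

/-- The Lipschitz constant `λ_p = ‖θ‖_∞ / (4 √(2n)) · ((3/2) d 𝔡)^((K+1) p)`, where `‖θ‖_∞` is the
largest absolute value of a parameter (the norm of a pair of finite families is the maximum). -/
def lambdaP (n d 𝔡 : ℕ) {K p : ℕ} (β : Fin p → ℝ) (γ : Fin p → Fin K → ℝ) : ℝ :=
  ‖(β, γ)‖ / (4 * Real.sqrt (2 * n)) * (3 / 2 * d * 𝔡) ^ ((K + 1) * p)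

end QAnneal

end

open QAnneal

/-! For fixed `ω` the estimate is deterministic once both instances `X`, `Y` have interaction degree
at most `𝔡`, and both marginals are concentrated on such instances (`ae_degreeLE_sparseDisorder`).

Turn the circuit for `X` into the circuit for `Y` one Pauli rotation at a time. Changing the angle
of one rotation by `δ` changes the state by an operator of trace norm at most `2|δ|`
(`absBound_evolve_sub_evolve`). Its partial trace over the support of the Pauli operator vanishes,
because an observable acting off that support commutes with the rotation (`vanishesOn_conjBy_sub`).
The evolutions that follow preserve the trace norm; each is generated by commuting local terms, so
it enlarges the set of qubits by a factor of at most `Q = max 1 (d𝔡)` (`spreads_evolve_sum`). Thus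
the final difference is a sum of operators `M_a` of trace norm at most `t_a` with vanishing partial
trace over `S_a`. `Cost` and `Near` keep track of the weight `w ≥ ∑ |S_a| t_a`, and
`near_annealCircuit` gives `w = Q^((K+1)p) · p · min 1 (d𝔡) · 2 (‖θ‖/n) ‖X - Y‖₁`.

An operator of trace norm at most `t` with vanishing partial trace over `S` is depolarized qubit by
qubit. The telescoping differences are `|S|` pieces of trace norm at most `3t/2`, each with
vanishing partial trace over one qubit (`exists_sum_of_vanishesOn`). The arithmetic-geometric mean
inequality linearizes the square roots in the norm, at the price of an additive `√n`
(`Cost.wassersteinNorm_le`). Only one factor `3/2` has been spent, so the power of `3/2` in `λ_p` is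
left to absorb `p` and the numerical constants (`stability_constant_le`). -/

namespace QAnneal

variable {n : ℕ}

/-! ### One-qubit operators and the operators that act trivially at a qubit -/

/-- The operator `m` acting on qubit `i`. -/
def loc (i : Fin n) (m : Matrix (Fin 2) (Fin 2) ℂ) : QOp n :=
  Matrix.of fun a b => if ∀ j, j ≠ i → a j = b j then m (a i) (b i) else 0

theorem loc_mul_apply (i : Fin n) (m : Matrix (Fin 2) (Fin 2) ℂ) (A : QOp n)
    (a b : Fin n → Fin 2) :
    (loc i m * A) a b = ∑ t, m (a i) t * A (Function.update a i t) b := by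
  rw [Matrix.mul_apply]
  symm
  refine Finset.sum_of_injOn (fun t => Function.update a i t) ?_ (by simp) ?_ ?_
  · intro s _ t _ h
    simpa using congrFun h i
  · intro c _ hc
    rw [loc, Matrix.of_apply, if_neg, zero_mul]
    intro h
    refine hc ⟨c i, by simp, ?_⟩
    ext j
    by_cases hj : j = i
    · subst hj; simp
    · simp [hj, h j hj]
  · intro t _
    rw [loc, Matrix.of_apply, if_pos]
    · simp
    · intro j hj; simp [hj]

theorem mul_loc_apply (i : Fin n) (m : Matrix (Fin 2) (Fin 2) ℂ) (A : QOp n)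
    (a b : Fin n → Fin 2) :
    (A * loc i m) a b = ∑ t, A a (Function.update b i t) * m t (b i) := by
  rw [Matrix.mul_apply]
  symm
  refine Finset.sum_of_injOn (fun t => Function.update b i t) ?_ (by simp) ?_ ?_
  · intro s _ t _ h
    simpa using congrFun h i
  · intro c _ hc
    rw [loc, Matrix.of_apply, if_neg, mul_zero]
    intro h
    refine hc ⟨c i, by simp, ?_⟩
    ext j
    by_cases hj : j = i
    · subst hj; simp
    · simp [hj, h j hj]
  · intro t _
    rw [loc, Matrix.of_apply, if_pos]
    · simp
    · intro j hj; simp [hj]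

theorem loc_one (i : Fin n) : loc i 1 = 1 := by
  ext a b
  simp only [loc, Matrix.of_apply, Matrix.one_apply]
  by_cases hab : a = b
  · simp [hab]
  · rw [if_neg hab]
    split_ifs with h h'
    · exact absurd (funext fun j => if hj : j = i then hj ▸ h' else h j hj) hab
    · rfl
    · rfl

theorem loc_mul_loc (i : Fin n) (m m' : Matrix (Fin 2) (Fin 2) ℂ) :
    loc i m * loc i m' = loc i (m * m') := by
  ext a b
  rw [loc_mul_apply]
  have h : ∀ t, (∀ j, j ≠ i → Function.update a i t j = b j) ↔ ∀ j, j ≠ i → a j = b j := by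
    intro t
    refine forall_congr' fun j => forall_congr' fun hj => ?_
    simp [hj]
  by_cases hab : ∀ j, j ≠ i → a j = b j
  · simp only [loc, Matrix.of_apply, h, if_pos hab, Matrix.mul_apply]
    simp
  · simp only [loc, Matrix.of_apply, h, if_neg hab]
    simp

theorem loc_conjTranspose (i : Fin n) (m : Matrix (Fin 2) (Fin 2) ℂ) :
    (loc i m).conjTranspose = loc i m.conjTranspose := by
  ext a b
  simp only [loc, Matrix.conjTranspose_apply, Matrix.of_apply]
  by_cases hab : ∀ j, j ≠ i → a j = b j
  · rw [if_pos hab, if_pos fun j hj => (hab j hj).symm]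
  · rw [if_neg hab, if_neg fun h => hab fun j hj => (h j hj).symm, star_zero]

theorem sigma_conjTranspose (k : Fin 4) : (sigma k).conjTranspose = sigma k := by
  fin_cases k <;> ext a b <;> fin_cases a <;> fin_cases b <;> simp [sigma]

theorem sigma_mul_self (k : Fin 4) : sigma k * sigma k = 1 := by
  fin_cases k <;> ext a b <;> fin_cases a <;> fin_cases b <;> simp [sigma]

theorem sigma_zero : sigma 0 = 1 := by
  ext a b; fin_cases a <;> fin_cases b <;> simp [sigma]

theorem sum_sigma_conj (A : Fin 2 → Fin 2 → ℂ) (a b : Fin 2) :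
    ∑ k, ∑ t, (∑ s, sigma k a s * A s t) * sigma k t b =
      if a = b then 2 * ∑ s, A s s else 0 := by
  fin_cases a <;> fin_cases b <;> simp [Fin.sum_univ_four, sigma, Fin.sum_univ_two] <;>
    ring_nf <;> simp [Complex.I_sq] <;> ring

theorem actsTriviallyAt_iff (O : QOp n) (i : Fin n) :
    ActsTriviallyAt O i ↔ (∀ a b, a i ≠ b i → O a b = 0) ∧
      ∀ a b, a i = b i → ∀ s, O (Function.update a i s) (Function.update b i s) = O a b := by
  constructor
  · rintro ⟨O', h⟩
    refine ⟨fun a b hab => by rw [h, if_neg hab], fun a b hab s => ?_⟩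
    rw [h, h, if_pos hab, if_pos (by simp)]
    congr 1 <;> ext j <;> simp [j.2]
  · rintro ⟨h0, h1⟩
    refine ⟨Matrix.of fun a b => O (glue i 0 a) (glue i 0 b), fun a b => ?_⟩
    have e : ∀ a : Fin n → Fin 2, glue i 0 (fun j => a j) = Function.update a i 0 := by
      intro a; ext j; by_cases hj : j = i <;> simp [glue, hj]
    split_ifs with hab
    · rw [Matrix.of_apply, e, e, h1 a b hab]
    · exact h0 a b hab

theorem ActsTriviallyAt.commute_loc {O : QOp n} {i : Fin n} (h : ActsTriviallyAt O i)
    (m : Matrix (Fin 2) (Fin 2) ℂ) : Commute O (loc i m) := by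
  obtain ⟨h0, h1⟩ := (actsTriviallyAt_iff O i).1 h
  ext a b
  rw [mul_loc_apply, loc_mul_apply, Finset.sum_eq_single (a i), Finset.sum_eq_single (b i)]
  · rw [mul_comm]
    congr 1
    have := h1 a (Function.update b i (a i)) (by simp) (b i)
    simpa using this.symm
  · intro t _ ht
    rw [h0 _ _ (by simpa using ht), mul_zero]
  · simp
  · intro t _ ht
    rw [h0 _ _ (by simpa using ht.symm), zero_mul]
  · simp

theorem actsTriviallyAt_loc {i j : Fin n} (hij : i ≠ j) (m : Matrix (Fin 2) (Fin 2) ℂ) :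
    ActsTriviallyAt (loc j m) i := by
  refine (actsTriviallyAt_iff _ i).2 ⟨fun a b hab => ?_, fun a b hab s => ?_⟩
  · rw [loc, Matrix.of_apply, if_neg fun h => hab (h i hij)]
  · have e : (∀ k, k ≠ j → Function.update a i s k = Function.update b i s k) ↔
        ∀ k, k ≠ j → a k = b k := by
      refine forall_congr' fun k => forall_congr' fun _ => ?_
      by_cases hk : k = i
      · subst hk; simp [hab]
      · simp [hk]
    simp only [loc, Matrix.of_apply, Function.update_of_ne hij.symm, e]

/-- The depolarization of qubit `i`. -/
noncomputable def depol (i : Fin n) (A : QOp n) : QOp n :=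
  (1 / 4 : ℂ) • ∑ k, loc i (sigma k) * A * loc i (sigma k)

/-- The Pauli twirl replaces qubit `i` by the maximally mixed state. -/
theorem depol_apply (i : Fin n) (A : QOp n) (a b : Fin n → Fin 2) :
    depol i A a b = if a i = b i then
      1 / 2 * ∑ s, A (Function.update a i s) (Function.update b i s) else 0 := by
  have := sum_sigma_conj (fun s t => A (Function.update a i s) (Function.update b i t)) (a i) (b i)
  simp only [depol, Matrix.smul_apply, Matrix.sum_apply, mul_loc_apply, loc_mul_apply, this]
  split_ifs <;> simp; ring

theorem actsTriviallyAt_depol (i : Fin n) (A : QOp n) : ActsTriviallyAt (depol i A) i := by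
  rw [actsTriviallyAt_iff]
  refine ⟨fun a b hab => by rw [depol_apply, if_neg hab], fun a b hab s => ?_⟩
  rw [depol_apply, depol_apply, if_pos hab, if_pos (by simp)]
  simp

theorem depol_eq_self {i : Fin n} {A : QOp n} (h : ∀ k, Commute A (loc i (sigma k))) :
    depol i A = A := by
  have : ∀ k, loc i (sigma k) * A * loc i (sigma k) = A := fun k => by
    rw [← (h k).eq, mul_assoc, loc_mul_loc, sigma_mul_self, loc_one, mul_one]
  simp only [depol, this, Finset.sum_const, Finset.card_univ, Fintype.card_fin]
  rw [← Nat.cast_smul_eq_nsmul ℂ, smul_smul]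
  norm_num

/-- An operator commuting with the Paulis at `i` is fixed by the twirl. As a commutant condition,
triviality passes to products, sums and exponentials. -/
theorem actsTriviallyAt_iff_commute (O : QOp n) (i : Fin n) :
    ActsTriviallyAt O i ↔ ∀ k, Commute O (loc i (sigma k)) :=
  ⟨fun h _ => h.commute_loc _, fun h => depol_eq_self h ▸ actsTriviallyAt_depol i O⟩

theorem ActsTriviallyAt.mul {O O' : QOp n} {i : Fin n} (h : ActsTriviallyAt O i)
    (h' : ActsTriviallyAt O' i) : ActsTriviallyAt (O * O') i := by
  rw [actsTriviallyAt_iff_commute] at *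
  exact fun k => (h k).mul_left (h' k)

theorem ActsTriviallyAt.smul {O : QOp n} {i : Fin n} (h : ActsTriviallyAt O i) (c : ℂ) :
    ActsTriviallyAt (c • O) i := by
  rw [actsTriviallyAt_iff_commute] at *
  exact fun k => (h k).smul_left c

theorem actsTriviallyAt_zero (i : Fin n) : ActsTriviallyAt (0 : QOp n) i := by
  rw [actsTriviallyAt_iff_commute]
  exact fun _ => Commute.zero_left _

theorem ActsTriviallyAt.sum {ι : Type*} {s : Finset ι} {O : ι → QOp n} {i : Fin n}
    (h : ∀ j ∈ s, ActsTriviallyAt (O j) i) : ActsTriviallyAt (∑ j ∈ s, O j) i := by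
  simp only [actsTriviallyAt_iff_commute] at *
  exact fun k => Commute.sum_left _ _ _ fun j hj => h j hj k

theorem ActsTriviallyAt.depol {O : QOp n} {i : Fin n} (h : ActsTriviallyAt O i) (j : Fin n) :
    ActsTriviallyAt (depol j O) i := by
  by_cases hij : i = j
  · subst hij; exact actsTriviallyAt_depol i O
  · refine (ActsTriviallyAt.sum fun k _ => ?_).smul _
    have hk : ActsTriviallyAt (loc j (sigma k)) i := actsTriviallyAt_loc hij _
    exact (hk.mul h).mul hk

theorem apply_eq_of_actsTriviallyAt {O : QOp n} {T : Finset (Fin n)}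
    (h : ∀ i ∈ T, ActsTriviallyAt O i) : ∀ {a b a' b' : Fin n → Fin 2},
    (∀ i ∈ T, a i = b i) → (∀ i ∈ T, a' i = b' i) → (∀ i ∉ T, a i = a' i) →
    (∀ i ∉ T, b i = b' i) → O a b = O a' b' := by
  induction T using Finset.induction_on with
  | empty =>
    intro a b a' b' _ _ ha hb
    rw [funext fun i => ha i (by simp), funext fun i => hb i (by simp)]
  | insert i T hi ih =>
    intro a b a' b' hab hab' ha hb
    rw [← ((actsTriviallyAt_iff O i).1 (h i (by simp))).2 a b (hab i (by simp)) (a' i)]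
    refine ih (fun j hj => h j (by simp [hj])) ?_ (fun j hj => hab' j (by simp [hj])) ?_ ?_
    · intro j hj
      have : j ≠ i := fun e => hi (e ▸ hj)
      simp [this, hab j (by simp [hj])]
    · intro j hj
      by_cases hji : j = i
      · subst hji; simp
      · simpa [hji] using ha j (by simp [hj, hji])
    · intro j hj
      by_cases hji : j = i
      · subst hji; simp [hab' j]
      · simpa [hji] using hb j (by simp [hj, hji])

theorem apply_eq_zero_of_actsTriviallyAt {O : QOp n} {i : Fin n} (h : ActsTriviallyAt O i)
    {a b : Fin n → Fin 2} (hab : a i ≠ b i) : O a b = 0 :=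
  ((actsTriviallyAt_iff O i).1 h).1 a b hab

/-- Operators supported on complementary sets of qubits commute. -/
theorem commute_of_actsTriviallyAt {O A : QOp n} {T : Finset (Fin n)}
    (hO : ∀ i ∈ T, ActsTriviallyAt O i) (hA : ∀ i ∉ T, ActsTriviallyAt A i) : Commute O A := by
  ext a c
  -- `O` is the identity on `T` and `A` off `T`, so exactly one intermediate basis label contributes
  -- to each of the two products.
  rw [Matrix.mul_apply, Matrix.mul_apply,
    Finset.sum_eq_single (fun i => if i ∈ T then a i else c i),
    Finset.sum_eq_single (fun i => if i ∈ T then c i else a i), mul_comm]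
  · congr 1
    · refine apply_eq_of_actsTriviallyAt (T := Tᶜ) (fun i hi => hA i (by simpa using hi)) ?_ ?_ ?_ ?_
        <;> intro i hi <;> simp_all
    · refine apply_eq_of_actsTriviallyAt hO ?_ ?_ ?_ ?_ <;> intro i hi <;> simp_all
  · intro b _ hb
    by_contra hne
    refine hb (funext fun i => ?_)
    split_ifs with hi
    · by_contra h
      exact hne (by rw [apply_eq_zero_of_actsTriviallyAt (hO i hi) h, mul_zero])
    · by_contra h
      exact hne (by rw [apply_eq_zero_of_actsTriviallyAt (hA i hi) (Ne.symm h), zero_mul])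
  · simp
  · intro b _ hb
    by_contra hne
    refine hb (funext fun i => ?_)
    split_ifs with hi
    · by_contra h
      exact hne (by rw [apply_eq_zero_of_actsTriviallyAt (hO i hi) (Ne.symm h), zero_mul])
    · by_contra h
      exact hne (by rw [apply_eq_zero_of_actsTriviallyAt (hA i hi) h, mul_zero])
  · simp

theorem actsTriviallyAt_of_notMem_opSupport {A : QOp n} {i : Fin n} (h : i ∉ opSupport A) :
    ActsTriviallyAt A i := by
  simpa [opSupport] using h

theorem mem_opSupport {A : QOp n} {i : Fin n} : i ∈ opSupport A ↔ ¬ ActsTriviallyAt A i := by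
  simp [opSupport]

theorem commute_of_actsTriviallyAt_opSupport {O A : QOp n}
    (h : ∀ i ∈ opSupport A, ActsTriviallyAt O i) : Commute O A :=
  commute_of_actsTriviallyAt h fun _ hi => actsTriviallyAt_of_notMem_opSupport hi

theorem opSupport_smul_subset (c : ℂ) (A : QOp n) : opSupport (c • A) ⊆ opSupport A := by
  intro i
  simp only [mem_opSupport]
  exact fun h h' => h (h'.smul c)

theorem opSupport_smul {c : ℂ} (hc : c ≠ 0) (A : QOp n) : opSupport (c • A) = opSupport A := by
  refine (opSupport_smul_subset c A).antisymm ?_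
  simpa [smul_smul, hc] using opSupport_smul_subset c⁻¹ (c • A)

theorem opSupport_zero : opSupport (0 : QOp n) = ∅ := by
  ext i; simp [mem_opSupport, actsTriviallyAt_zero]

/-! ### Partial traces -/

theorem update_glue (i : Fin n) (s t : Fin 2) (a : {j // j ≠ i} → Fin 2) :
    Function.update (glue i s a) i t = glue i t a := by
  ext j; by_cases hj : j = i
  · subst hj; simp [glue]
  · simp [glue, hj]

theorem glue_self (i : Fin n) (s : Fin 2) (a : {j // j ≠ i} → Fin 2) : glue i s a i = s := by
  simp [glue]

theorem partialTrace_loc_mul (i : Fin n) (m : Matrix (Fin 2) (Fin 2) ℂ) (A : QOp n) :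
    partialTrace i (loc i m * A) = partialTrace i (A * loc i m) := by
  ext a b
  simp only [partialTrace, Matrix.of_apply, loc_mul_apply, mul_loc_apply, update_glue, glue_self]
  rw [Finset.sum_comm]
  simp only [mul_comm]

theorem partialTrace_add (i : Fin n) (A B : QOp n) :
    partialTrace i (A + B) = partialTrace i A + partialTrace i B := by
  ext a b
  simp [partialTrace]; ring

theorem partialTrace_smul (i : Fin n) (c : ℂ) (A : QOp n) :
    partialTrace i (c • A) = c • partialTrace i A := by
  ext a b
  simp [partialTrace]; ring

theorem partialTrace_sum (i : Fin n) {ι : Type*} (s : Finset ι) (A : ι → QOp n) :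
    partialTrace i (∑ j ∈ s, A j) = ∑ j ∈ s, partialTrace i (A j) := by
  ext a b
  simp [partialTrace, Matrix.sum_apply, Finset.sum_add_distrib]

theorem partialTrace_sub (i : Fin n) (A B : QOp n) :
    partialTrace i (A - B) = partialTrace i A - partialTrace i B := by
  ext a b
  simp [partialTrace]

theorem partialTrace_depol (i : Fin n) (A : QOp n) :
    partialTrace i (depol i A) = partialTrace i A := by
  have h : ∀ k, partialTrace i (loc i (sigma k) * A * loc i (sigma k)) = partialTrace i A := by
    intro k
    rw [mul_assoc, partialTrace_loc_mul, mul_assoc, loc_mul_loc, sigma_mul_self, loc_one, mul_one]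
  rw [depol, partialTrace_smul, partialTrace_sum]
  simp only [h, Finset.sum_const, Finset.card_univ, Fintype.card_fin]
  rw [← Nat.cast_smul_eq_nsmul ℂ, smul_smul]
  norm_num

/-- Depolarization is self-adjoint for the trace pairing, so it can be moved onto the observable. -/
theorem trace_mul_depol (i : Fin n) (O A : QOp n) :
    (O * depol i A).trace = (depol i O * A).trace := by
  simp only [depol, Matrix.mul_smul, Matrix.smul_mul, Matrix.trace_smul, Matrix.mul_sum,
    Matrix.sum_mul, Matrix.trace_sum]
  congr 1
  refine Finset.sum_congr rfl fun k _ => ?_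
  rw [← mul_assoc, Matrix.trace_mul_comm]
  simp only [mul_assoc]

/-! ### Pauli operators -/

theorem pauli_mul_self (x : Fin n → Fin 4) : pauli x * pauli x = 1 := by
  ext a b
  have h : ∀ i, ∑ s, sigma (x i) (a i) s * sigma (x i) s (b i) = if a i = b i then 1 else 0 := by
    intro i
    rw [← Matrix.mul_apply, sigma_mul_self, Matrix.one_apply]
  simp only [Matrix.mul_apply, pauli, Matrix.of_apply, ← Finset.prod_mul_distrib]
  rw [← Fintype.piFinset_univ,
    ← Finset.prod_univ_sum (fun _ => Finset.univ)
      (fun i s => sigma (x i) (a i) s * sigma (x i) s (b i)), Matrix.one_apply]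
  simp only [h]
  split_ifs with hab
  · simp [hab]
  · obtain ⟨i, hi⟩ := Function.ne_iff.1 hab
    exact Finset.prod_eq_zero (Finset.mem_univ i) (if_neg hi)

theorem pauli_isHermitian (x : Fin n → Fin 4) : (pauli x).IsHermitian := by
  ext a b
  simp only [Matrix.conjTranspose_apply, pauli, Matrix.of_apply, star_prod]
  refine Finset.prod_congr rfl fun i _ => ?_
  rw [← Matrix.conjTranspose_apply, sigma_conjTranspose]

theorem opSupport_pauli_card_le (x : Fin n → Fin 4) :
    (opSupport (pauli x)).card ≤ pauliWeight x := by
  refine Finset.card_le_card fun i hi => ?_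
  rw [mem_opSupport] at hi
  simp only [Finset.mem_filter, Finset.mem_univ, true_and]
  intro hx
  refine hi ((actsTriviallyAt_iff _ i).2 ⟨fun a b hab => ?_, fun a b hab s => ?_⟩)
  · rw [pauli, Matrix.of_apply]
    refine Finset.prod_eq_zero (Finset.mem_univ i) ?_
    rw [hx, sigma_zero, Matrix.one_apply_ne hab]
  · simp only [pauli, Matrix.of_apply]
    refine Finset.prod_congr rfl fun j _ => ?_
    by_cases hj : j = i
    · subst hj; simp [hx, sigma_zero, hab]
    · simp [hj]

/-! ### The trace norm -/

/-- `A` is a difference of positive semidefinite operators with traces summing to at most `t`. -/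
def AbsBound (A : QOp n) (t : ℝ) : Prop :=
  ∃ P N : QOp n, P.PosSemidef ∧ N.PosSemidef ∧ A = P - N ∧ P.trace.re + N.trace.re ≤ t

theorem AbsBound.isHermitian {A : QOp n} {t : ℝ} (h : AbsBound A t) : A.IsHermitian := by
  obtain ⟨P, N, hP, hN, rfl, -⟩ := h
  exact hP.isHermitian.sub hN.isHermitian

theorem AbsBound.nonneg {A : QOp n} {t : ℝ} (h : AbsBound A t) : 0 ≤ t := by
  obtain ⟨P, N, hP, hN, -, ht⟩ := h
  exact (add_nonneg (Complex.nonneg_iff.1 hP.trace_nonneg).1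
    (Complex.nonneg_iff.1 hN.trace_nonneg).1).trans ht

theorem AbsBound.mono {A : QOp n} {t t' : ℝ} (h : AbsBound A t) (htt' : t ≤ t') :
    AbsBound A t' := by
  obtain ⟨P, N, hP, hN, hA, ht⟩ := h
  exact ⟨P, N, hP, hN, hA, ht.trans htt'⟩

theorem absBound_zero : AbsBound (0 : QOp n) 0 :=
  ⟨0, 0, .zero, .zero, by simp, by simp⟩

theorem AbsBound.add {A B : QOp n} {t t' : ℝ} (h : AbsBound A t) (h' : AbsBound B t') :
    AbsBound (A + B) (t + t') := by
  obtain ⟨P, N, hP, hN, rfl, ht⟩ := h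
  obtain ⟨P', N', hP', hN', rfl, ht'⟩ := h'
  refine ⟨P + P', N + N', hP.add hP', hN.add hN', by abel, ?_⟩
  simp only [Matrix.trace_add, Complex.add_re]
  linarith

theorem AbsBound.sum {ι : Type*} {s : Finset ι} {A : ι → QOp n} {t : ι → ℝ}
    (h : ∀ i ∈ s, AbsBound (A i) (t i)) : AbsBound (∑ i ∈ s, A i) (∑ i ∈ s, t i) := by
  classical
  induction s using Finset.induction_on with
  | empty => simpa using absBound_zero
  | insert i s hi ih =>
    rw [Finset.sum_insert hi, Finset.sum_insert hi]
    exact (h i (by simp)).add (ih fun j hj => h j (by simp [hj]))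

theorem AbsBound.smul {A : QOp n} {t : ℝ} (h : AbsBound A t) (c : ℝ) :
    AbsBound ((c : ℂ) • A) (|c| * t) := by
  obtain ⟨P, N, hP, hN, rfl, ht⟩ := h
  have key : |c| * P.trace.re + |c| * N.trace.re ≤ |c| * t := by
    rw [← mul_add]; exact mul_le_mul_of_nonneg_left ht (abs_nonneg c)
  rcases le_total 0 c with hc | hc
  · rw [abs_of_nonneg hc] at key ⊢
    refine ⟨(c : ℂ) • P, (c : ℂ) • N, hP.smul (by exact_mod_cast hc),
      hN.smul (by exact_mod_cast hc), smul_sub _ _ _, ?_⟩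
    simpa using key
  · rw [abs_of_nonpos hc] at key ⊢
    have hc' : (0 : ℂ) ≤ -(c : ℂ) := by
      rw [← Complex.ofReal_neg]; exact_mod_cast neg_nonneg.2 hc
    refine ⟨(-(c : ℂ)) • N, (-(c : ℂ)) • P, hN.smul hc', hP.smul hc', ?_, ?_⟩
    · simp only [smul_sub, neg_smul]; abel
    · simp only [Matrix.trace_smul, smul_eq_mul, neg_mul, Complex.neg_re, Complex.re_ofReal_mul]
      linarith

theorem AbsBound.conj {A : QOp n} {t : ℝ} (h : AbsBound A t) {U : QOp n}
    (hU : U.conjTranspose * U = 1) : AbsBound (U * A * U.conjTranspose) t := by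
  obtain ⟨P, N, hP, hN, rfl, ht⟩ := h
  refine ⟨_, _, hP.mul_mul_conjTranspose_same U, hN.mul_mul_conjTranspose_same U, ?_, ?_⟩
  · rw [mul_sub, sub_mul]
  · rwa [Matrix.trace_mul_comm, ← mul_assoc, hU, one_mul, Matrix.trace_mul_comm, ← mul_assoc, hU,
      one_mul]

theorem traceNorm_nonneg (A : QOp n) : 0 ≤ traceNorm A :=
  Finset.sum_nonneg fun _ _ => Real.sqrt_nonneg _

/-- Diagonalizing `A` shows that `Aᴴ A` has the squared eigenvalues of `A` as the roots of its
characteristic polynomial; compare the two multisets of roots. -/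
theorem traceNorm_eq_sum_abs_eigenvalues {A : QOp n} (hA : A.IsHermitian) :
    traceNorm A = ∑ a, |hA.eigenvalues a| := by
  have h := Matrix.isHermitian_conjTranspose_mul_self A
  have e : (A.conjTranspose * A).charpoly =
      ∏ a, (Polynomial.X - Polynomial.C (((hA.eigenvalues a) ^ 2 : ℝ) : ℂ)) := by
    rw [hA.eq]
    conv_lhs => rw [hA.spectral_theorem, ← map_mul, Unitary.conjStarAlgAut_apply,
      Matrix.charpoly_mul_comm, ← mul_assoc]
    simp [Matrix.charpoly_diagonal, sq]
  have h1 := h.roots_charpoly_eq_eigenvalues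
  rw [e, Polynomial.roots_prod _ _
    (Finset.prod_ne_zero_iff.2 fun _ _ => Polynomial.X_sub_C_ne_zero _)] at h1
  simp only [Polynomial.roots_X_sub_C, Multiset.bind_singleton] at h1
  have h2 := congrArg (fun s => (Multiset.map (fun z : ℂ => Real.sqrt z.re) s).sum) h1
  simp only [Multiset.map_map] at h2
  rw [traceNorm]
  symm
  calc ∑ a, |hA.eigenvalues a| = ∑ a, Real.sqrt (((hA.eigenvalues a ^ 2 : ℝ) : ℂ).re) := by
        refine Finset.sum_congr rfl fun a _ => ?_
        rw [Complex.ofReal_re, Real.sqrt_sq_eq_abs]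
    _ = _ := h2

/-- In an eigenbasis of `A = P - N`, each `|λ_a|` is at most `P_aa + N_aa`. This is how `AbsBound`,
for which the triangle inequality and unitary invariance are immediate, controls the trace norm. -/
theorem traceNorm_le_of_absBound {A : QOp n} {t : ℝ} (h : AbsBound A t) : traceNorm A ≤ t := by
  have hA := h.isHermitian
  rw [traceNorm_eq_sum_abs_eigenvalues hA]
  obtain ⟨P, N, hP, hN, hPN, ht⟩ := h
  set U : QOp n := (hA.eigenvectorUnitary : QOp n)
  have hUU : U * star U = 1 := Unitary.coe_mul_star_self _
  have hd : star U * A * U = Matrix.diagonal (RCLike.ofReal ∘ hA.eigenvalues) := by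
    have := hA.conjStarAlgAut_star_eigenvectorUnitary
    rwa [Unitary.conjStarAlgAut_star_apply] at this
  have hP' := hP.conjTranspose_mul_mul_same U
  have hN' := hN.conjTranspose_mul_mul_same U
  have tr : ∀ B : QOp n, (U.conjTranspose * B * U).trace = B.trace := fun B => by
    rw [Matrix.trace_mul_comm, ← mul_assoc]
    change (U * star U * B).trace = _
    rw [hUU, one_mul]
  have key : ∀ a, |hA.eigenvalues a| ≤
      ((U.conjTranspose * P * U) a a).re + ((U.conjTranspose * N * U) a a).re := by
    intro a
    have h1 : hA.eigenvalues a =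
        ((U.conjTranspose * P * U) a a).re - ((U.conjTranspose * N * U) a a).re := by
      rw [← Complex.sub_re, ← Matrix.sub_apply, ← sub_mul, ← mul_sub, ← hPN]
      change _ = ((star U * A * U) a a).re
      rw [hd]
      simp
    have h2 := (Complex.nonneg_iff.1 (hP'.diag_nonneg (i := a))).1
    have h3 := (Complex.nonneg_iff.1 (hN'.diag_nonneg (i := a))).1
    rw [h1, abs_le]
    constructor <;> linarith
  refine (Finset.sum_le_sum fun a _ => key a).trans ?_
  rw [Finset.sum_add_distrib, ← Complex.re_sum, ← Complex.re_sum]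
  refine le_trans (le_of_eq ?_) ht
  rw [← tr P, ← tr N]
  rfl

/-! ### Operators with vanishing partial trace over a set of qubits -/

/-- The partial trace of `M` over the qubits in `S` vanishes, in its dual form. -/
def VanishesOn (S : Finset (Fin n)) (M : QOp n) : Prop :=
  ∀ O : QOp n, (∀ i ∈ S, ActsTriviallyAt O i) → (O * M).trace = 0

theorem eq_zero_of_trace_mul {M : QOp n} (h : ∀ O : QOp n, (O * M).trace = 0) : M = 0 :=
  Matrix.trace_mul_conjTranspose_self_eq_zero_iff.1 (by
    rw [Matrix.trace_mul_comm]; exact h M.conjTranspose)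

theorem loc_sigma_isHermitian (i : Fin n) (k : Fin 4) : (loc i (sigma k)).IsHermitian := by
  rw [Matrix.IsHermitian, loc_conjTranspose, sigma_conjTranspose]

theorem AbsBound.loc_conj {A : QOp n} {t : ℝ} (h : AbsBound A t) (i : Fin n) (k : Fin 4) :
    AbsBound (loc i (sigma k) * A * loc i (sigma k)) t := by
  have := h.conj (U := loc i (sigma k))
    (by rw [loc_sigma_isHermitian, loc_mul_loc, sigma_mul_self, loc_one])
  rwa [loc_sigma_isHermitian] at this

theorem AbsBound.depol {A : QOp n} {t : ℝ} (h : AbsBound A t) (i : Fin n) :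
    AbsBound (depol i A) t := by
  have h1 := (AbsBound.sum (s := Finset.univ) fun k _ => h.loc_conj i k).smul (1 / 4)
  refine AbsBound.mono (t := _) (by simpa [QAnneal.depol] using h1) ?_
  simp

theorem AbsBound.sub_depol {A : QOp n} {t : ℝ} (h : AbsBound A t) (i : Fin n) :
    AbsBound (A - QAnneal.depol i A) (3 / 2 * t) := by
  have h1 := (AbsBound.sum (s := Finset.univ) fun k : Fin 3 => fun _ =>
    h.loc_conj i k.succ).smul (-(1 / 4))
  have h2 := (h.smul (3 / 4)).add h1
  -- The identity term of the twirl cancels a quarter of `A`; what remains costs `3/4 + 3 · 1/4 =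
  -- 3/2`.
  have e : A - QAnneal.depol i A = (((3 / 4 : ℝ)) : ℂ) • A +
      ((-(1 / 4) : ℝ) : ℂ) •
        ∑ k : Fin 3, loc i (sigma k.succ) * A * loc i (sigma k.succ) := by
    rw [QAnneal.depol, Fin.sum_univ_succ, sigma_zero, loc_one, one_mul, mul_one]
    push_cast
    module
  rw [e]
  refine h2.mono ?_
  simp [abs_of_pos]
  linarith

/-- `R` is `M` depolarized at all qubits of `S`, and the `Y i` are the telescoping differences. The
last clause moves the depolarizations from `R` to the observable; it keeps track of trivial qubits
so that those treated earlier stay trivial. -/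
theorem exists_sum_of_vanishesOn_aux {M : QOp n} {t : ℝ} (hM : AbsBound M t)
    (S : Finset (Fin n)) :
    ∃ (Y : Fin n → QOp n) (R : QOp n), M = R + ∑ i, Y i ∧ AbsBound R t ∧
      (∀ i, AbsBound (Y i) (if i ∈ S then 3 / 2 * t else 0)) ∧
      (∀ i, partialTrace i (Y i) = 0) ∧
      ∀ O : QOp n, ∃ O' : QOp n, (O * R).trace = (O' * M).trace ∧
        (∀ i ∈ S, ActsTriviallyAt O' i) ∧ ∀ i, ActsTriviallyAt O i → ActsTriviallyAt O' i := by
  induction S using Finset.induction_on with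
  | empty =>
    refine ⟨0, M, by simp, hM, fun i => by simpa using absBound_zero, fun i => ?_,
      fun O => ⟨O, rfl, by simp, fun _ h => h⟩⟩
    ext a b; simp [partialTrace]
  | insert j S hj ih =>
    obtain ⟨Y, R, hMR, hR, hY, hY0, hO⟩ := ih
    -- The slot `j` is still empty, so overwriting it loses nothing.
    have hYj : Y j = 0 := by
      have h := hY j
      rw [if_neg hj] at h
      have hh := h.isHermitian
      have h0 := traceNorm_le_of_absBound h
      rw [traceNorm_eq_sum_abs_eigenvalues hh] at h0
      have h1 := (Finset.sum_eq_zero_iff_of_nonneg fun a _ => abs_nonneg _).1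
        (h0.antisymm (Finset.sum_nonneg fun a _ => abs_nonneg _))
      exact hh.eigenvalues_eq_zero_iff.1 (funext fun a => abs_eq_zero.1 (h1 a (by simp)))
    refine ⟨Function.update Y j (R - depol j R), depol j R, ?_, hR.depol j, fun i => ?_,
      fun i => ?_, fun O => ?_⟩
    · rw [Finset.sum_update_of_mem (Finset.mem_univ j), hMR,
        ← Finset.add_sum_erase _ _ (Finset.mem_univ j), hYj, Finset.sdiff_singleton_eq_erase]
      abel
    · by_cases hi : i = j
      · subst hi
        simpa using hR.sub_depol i
      · simpa [hi] using hY i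
    · by_cases hi : i = j
      · subst hi
        simp [partialTrace_sub, partialTrace_depol]
      · simpa [hi] using hY0 i
    · obtain ⟨O', h1, h2, h3⟩ := hO (depol j O)
      refine ⟨O', by rw [trace_mul_depol, h1], fun i hi => ?_, fun i hi => h3 i (hi.depol j)⟩
      rcases Finset.mem_insert.1 hi with rfl | hi
      · exact h3 _ (actsTriviallyAt_depol _ _)
      · exact h2 i hi

theorem exists_sum_of_vanishesOn {M : QOp n} {t : ℝ} (hM : AbsBound M t)
    {S : Finset (Fin n)} (hS : VanishesOn S M) :
    ∃ Y : Fin n → QOp n, M = ∑ i, Y i ∧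
      (∀ i, AbsBound (Y i) (if i ∈ S then 3 / 2 * t else 0)) ∧
      ∀ i, partialTrace i (Y i) = 0 := by
  obtain ⟨Y, R, hMR, -, hY, hY0, hO⟩ := exists_sum_of_vanishesOn_aux hM S
  have hR : R = 0 := eq_zero_of_trace_mul fun O => by
    obtain ⟨O', h1, h2, -⟩ := hO O
    rw [h1, hS O' h2]
  exact ⟨Y, by rwa [hR, zero_add] at hMR, hY, hY0⟩

/-! ### Sums of operators with vanishing partial traces, weighted by the number of qubits -/

/-- `M` is a sum of operators `M_a` of trace norm at most `t_a` whose partial trace over a set of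
qubits `S_a` vanishes, and `∑ a, |S_a| t_a ≤ w`. -/
inductive Cost : QOp n → ℝ → Prop
  | zero : Cost 0 0
  | base {M : QOp n} {t : ℝ} {S : Finset (Fin n)} : AbsBound M t → VanishesOn S M →
      Cost M (S.card * t)
  | sum {M N : QOp n} {v w : ℝ} : Cost M v → Cost N w → Cost (M + N) (v + w)
  | mono {M : QOp n} {v w : ℝ} : Cost M v → v ≤ w → Cost M w

theorem Cost.exists_decomposition {M : QOp n} {w : ℝ} (h : Cost M w) :
    ∃ (Y : Fin n → QOp n) (t : Fin n → ℝ), Y ∈ decompositions M ∧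
      (∀ i, AbsBound (Y i) (t i)) ∧ ∑ i, t i ≤ 3 / 2 * w := by
  induction h with
  | zero =>
    refine ⟨0, 0, ⟨by simp, fun i => Matrix.isHermitian_zero, fun i => ?_⟩,
      fun i => absBound_zero, by simp⟩
    ext a b; simp [partialTrace]
  | @base M t S hM hS =>
    obtain ⟨Y, h1, h2, h3⟩ := exists_sum_of_vanishesOn hM hS
    refine ⟨Y, _, ⟨h1, fun i => (h2 i).isHermitian, h3⟩, h2, le_of_eq ?_⟩
    simp only [Finset.sum_ite_mem, Finset.univ_inter, Finset.sum_const, nsmul_eq_mul]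
    ring
  | sum _ _ ih ih' =>
    obtain ⟨Y, t, hY, ht, hw⟩ := ih
    obtain ⟨Y', t', hY', ht', hw'⟩ := ih'
    have hb := fun i => (ht i).add (ht' i)
    refine ⟨Y + Y', t + t', ⟨?_, fun i => (hb i).isHermitian, fun i => ?_⟩, hb, ?_⟩
    · simp [Finset.sum_add_distrib, hY.1, hY'.1]
    · simp [partialTrace_add, hY.2.2 i, hY'.2.2 i]
    · simp only [Pi.add_apply, Finset.sum_add_distrib]; linarith
  | mono _ hvw ih =>
    obtain ⟨Y, t, hY, ht, hw⟩ := ih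
    exact ⟨Y, t, hY, ht, by linarith⟩

theorem Cost.wassersteinNorm_le {M : QOp n} {w : ℝ} (h : Cost M w) :
    wassersteinNorm 2 M ≤ Real.sqrt n + 3 / 16 * Real.sqrt n * w := by
  obtain ⟨Y, t, hY, ht, hw⟩ := h.exists_decomposition
  have hle : wassersteinNorm 2 M ≤ ∑ i, (traceNorm (Y i) / 2) ^ (1 / 2 : ℝ) := by
    refine csInf_le ⟨0, ?_⟩ ⟨Y, hY, rfl⟩
    rintro _ ⟨Z, -, rfl⟩
    exact Finset.sum_nonneg fun i _ =>
      Real.rpow_nonneg (div_nonneg (traceNorm_nonneg _) zero_le_two) _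
  refine hle.trans ?_
  have hn : Real.sqrt n * Real.sqrt n = n := Real.mul_self_sqrt n.cast_nonneg
  -- `√(4ab) ≤ a + b` with `a = 1/√n` and `b = √n t_i / 8`; the choice of `a` makes the `n`
  -- constants add up to `√n`.
  have key : ∀ i, (traceNorm (Y i) / 2) ^ (1 / 2 : ℝ) ≤
      1 / Real.sqrt n + Real.sqrt n / 8 * t i := by
    intro i
    have hn0 : 0 < Real.sqrt n := Real.sqrt_pos.2 (Nat.cast_pos.2 i.pos)
    rw [← Real.sqrt_eq_rpow]
    refine (Real.sqrt_le_sqrt (y := t i / 2) ?_).trans ?_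
    · linarith [traceNorm_le_of_absBound (ht i)]
    · rw [Real.sqrt_le_left (by have := (ht i).nonneg; positivity)]
      have e : (1 / Real.sqrt n + Real.sqrt n / 8 * t i) ^ 2 - t i / 2 =
          (1 / Real.sqrt n - Real.sqrt n / 8 * t i) ^ 2 := by
        field_simp; ring
      nlinarith [sq_nonneg (1 / Real.sqrt n - Real.sqrt n / 8 * t i)]
  refine (Finset.sum_le_sum fun i _ => key i).trans ?_
  rw [Finset.sum_add_distrib, ← Finset.mul_sum, Finset.sum_const, Finset.card_univ,
    Fintype.card_fin, nsmul_eq_mul]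
  have h1 : (n : ℝ) * (1 / Real.sqrt n) = Real.sqrt n := by
    rw [mul_one_div, Real.div_sqrt]
  rw [h1]
  have := mul_le_mul_of_nonneg_left hw (show (0 : ℝ) ≤ Real.sqrt n / 8 by positivity)
  linarith

/-! ### Time evolutions -/

theorem evolve_add {H H' : QOp n} (h : Commute H H') (t : ℝ) :
    evolve t (H + H') = evolve t H * evolve t H' := by
  rw [evolve, smul_add, Matrix.exp_add_of_commute _ _ ((h.smul_left _).smul_right _)]
  rfl

theorem evolve_conjTranspose {H : QOp n} (h : H.IsHermitian) (t : ℝ) :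
    (evolve t H).conjTranspose = evolve (-t) H := by
  rw [evolve, ← Matrix.exp_conjTranspose, Matrix.conjTranspose_smul, h.eq, evolve]
  simp

theorem evolve_add_left (H : QOp n) (s t : ℝ) : evolve (s + t) H = evolve s H * evolve t H := by
  rw [evolve, Complex.ofReal_add, mul_add, add_smul,
    Matrix.exp_add_of_commute _ _ (((Commute.refl H).smul_left _).smul_right _)]
  rfl

theorem evolve_zero_left (H : QOp n) : evolve 0 H = 1 := by
  simp [evolve]

theorem evolve_mul (s c : ℝ) (H : QOp n) : evolve s ((c : ℂ) • H) = evolve (s * c) H := by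
  rw [evolve, evolve, smul_smul, Complex.ofReal_mul, mul_assoc]

theorem commute_evolve_right {A H : QOp n} (h : Commute A H) (t : ℝ) :
    Commute A (evolve t H) := by
  open scoped Matrix.Norms.Operator in
  exact (h.smul_right _).exp_right

theorem commute_evolve {A H : QOp n} (h : Commute A H) (s t : ℝ) :
    Commute (evolve s A) (evolve t H) :=
  (commute_evolve_right (commute_evolve_right h.symm s).symm t)

/-- `U` is unitary. -/
def IsUnitaryOp (U : QOp n) : Prop :=
  U.conjTranspose * U = 1

theorem isUnitaryOp_one : IsUnitaryOp (1 : QOp n) := by simp [IsUnitaryOp]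

theorem IsUnitaryOp.mul {U V : QOp n} (hU : IsUnitaryOp U) (hV : IsUnitaryOp V) :
    IsUnitaryOp (U * V) := by
  unfold IsUnitaryOp at *
  rw [Matrix.conjTranspose_mul, mul_assoc, ← mul_assoc _ U, hU, one_mul, hV]

theorem isUnitaryOp_evolve {H : QOp n} (h : H.IsHermitian) (t : ℝ) : IsUnitaryOp (evolve t H) := by
  rw [IsUnitaryOp, evolve_conjTranspose h, ← evolve_add_left, neg_add_cancel, evolve_zero_left]

/-- Conjugation by an operator. -/
def conjBy (U ρ : QOp n) : QOp n := U * ρ * U.conjTranspose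

theorem conjBy_mul (U V ρ : QOp n) : conjBy (U * V) ρ = conjBy U (conjBy V ρ) := by
  simp only [conjBy, Matrix.conjTranspose_mul, mul_assoc]

theorem conjBy_one (ρ : QOp n) : conjBy 1 ρ = ρ := by simp [conjBy]

theorem conjBy_add (U ρ σ : QOp n) : conjBy U (ρ + σ) = conjBy U ρ + conjBy U σ := by
  simp only [conjBy, mul_add, add_mul]

theorem conjBy_sub (U ρ σ : QOp n) : conjBy U (ρ - σ) = conjBy U ρ - conjBy U σ := by
  simp only [conjBy, mul_sub, sub_mul]

theorem IsMixedState.conjBy {ρ : QOp n} (h : IsMixedState ρ) {U : QOp n} (hU : IsUnitaryOp U) :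
    IsMixedState (conjBy U ρ) := by
  refine ⟨h.1.mul_mul_conjTranspose_same U, ?_⟩
  rw [QAnneal.conjBy, Matrix.trace_mul_comm, ← mul_assoc, show _ = _ from hU, one_mul, h.2]

theorem trace_mul_conjBy (O U ρ : QOp n) :
    (O * conjBy U ρ).trace = (U.conjTranspose * O * U * ρ).trace := by
  rw [conjBy, ← mul_assoc, Matrix.trace_mul_comm]
  simp only [mul_assoc]

/-! ### Rotations by involutions -/

/-- The complementary idempotents `(1 ± P)/2` give a continuous ring homomorphism from `ℂ × ℂ`
sending `(z, -z)` to `z • P`, and it commutes with the exponential. -/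
theorem evolve_involution {P : QOp n} (hP : P * P = 1) (t : ℝ) :
    evolve t P = (Real.cos t : ℂ) • 1 - (Complex.I * Real.sin t) • P := by
  have key : ∀ z : ℂ, NormedSpace.exp (z • P) =
      (Complex.exp z / 2) • (1 + P) + (Complex.exp (-z) / 2) • (1 - P) := by
    intro z
    have h1 : (2⁻¹ : ℂ) • (1 + P) * ((2⁻¹ : ℂ) • (1 + P)) = (2⁻¹ : ℂ) • (1 + P) := by
      rw [smul_mul_smul_comm, add_mul, mul_add, mul_add, hP]
      simp only [one_mul, mul_one]
      module
    have h2 : (2⁻¹ : ℂ) • (1 - P) * ((2⁻¹ : ℂ) • (1 - P)) = (2⁻¹ : ℂ) • (1 - P) := by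
      rw [smul_mul_smul_comm, sub_mul, mul_sub, mul_sub, hP]
      simp only [one_mul, mul_one]
      module
    have h3 : (2⁻¹ : ℂ) • (1 + P) * ((2⁻¹ : ℂ) • (1 - P)) = 0 := by
      rw [smul_mul_smul_comm, add_mul, mul_sub, mul_sub, hP]
      simp only [one_mul, mul_one]
      module
    have h4 : (2⁻¹ : ℂ) • (1 - P) * ((2⁻¹ : ℂ) • (1 + P)) = 0 := by
      rw [smul_mul_smul_comm, sub_mul, mul_add, mul_add, hP]
      simp only [one_mul, mul_one]
      module
    let f : ℂ × ℂ →+* QOp n :=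
      { toFun := fun w => w.1 • ((2⁻¹ : ℂ) • (1 + P)) + w.2 • ((2⁻¹ : ℂ) • (1 - P))
        map_one' := by simp only [Prod.fst_one, Prod.snd_one]; module
        map_zero' := by simp
        map_add' := fun w v => by simp only [Prod.fst_add, Prod.snd_add]; module
        map_mul' := fun w v => by
          rw [add_mul, mul_add, mul_add]
          simp only [smul_mul_smul_comm w.1, smul_mul_smul_comm w.2, h1, h2, h3, h4]
          simp }
    have hf : Continuous f := by
      change Continuous fun w : ℂ × ℂ =>
        w.1 • ((2⁻¹ : ℂ) • (1 + P)) + w.2 • ((2⁻¹ : ℂ) • (1 - P))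
      fun_prop
    have hz : f (z, -z) = z • P := by
      change z • ((2⁻¹ : ℂ) • (1 + P)) + (-z) • ((2⁻¹ : ℂ) • (1 - P)) = _
      module
    have hexp : NormedSpace.exp ((z, -z) : ℂ × ℂ) = (Complex.exp z, Complex.exp (-z)) := by
      ext
      · rw [Prod.fst_exp, Complex.exp_eq_exp_ℂ]
      · rw [Prod.snd_exp, Complex.exp_eq_exp_ℂ]
    have : f (NormedSpace.exp (z, -z)) = NormedSpace.exp (f (z, -z)) := by
      open scoped Matrix.Norms.Operator in exact NormedSpace.map_exp f hf (z, -z)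
    rw [← hz, ← this, hexp]
    change Complex.exp z • ((2⁻¹ : ℂ) • (1 + P)) + Complex.exp (-z) • ((2⁻¹ : ℂ) • (1 - P)) = _
    module
  rw [evolve, key, Complex.ofReal_cos, Complex.ofReal_sin, Complex.cos, Complex.sin]
  have e1 : -Complex.I * (t : ℂ) = -(t : ℂ) * Complex.I := by ring
  have e2 : -(-(t : ℂ) * Complex.I) = t * Complex.I := by ring
  rw [e1, e2]
  match_scalars
  · ring
  · linear_combination (Complex.exp (-(t : ℂ) * Complex.I) - Complex.exp (t * Complex.I)) / 2 *
      Complex.I_sq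

/-- Since `(1 ± iP)/√2` is unitary, the commutator is the difference of two conjugates of `ρ`, each
a state. -/
theorem absBound_commutator {P ρ : QOp n} (hP : P * P = 1) (hPh : P.IsHermitian)
    (hρ : IsMixedState ρ) : AbsBound (Complex.I • (ρ * P - P * ρ)) 2 := by
  have hB : ∀ z : ℂ, z * star z = 1 → z + star z = 0 →
      (((2⁻¹ : ℂ)) • ((1 + z • P) * ρ * (1 + z • P).conjTranspose)).trace = 1 := by
    intro z hz hz'
    rw [Matrix.trace_smul, Matrix.trace_mul_comm, ← mul_assoc]
    have : (1 + z • P).conjTranspose * (1 + z • P) = (2 : ℂ) • (1 : QOp n) := by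
      rw [Matrix.conjTranspose_add, Matrix.conjTranspose_smul, Matrix.conjTranspose_one, hPh.eq,
        add_mul, mul_add, mul_add, smul_mul_smul_comm, hP, mul_comm, hz, one_mul, one_mul, mul_one]
      have : star z = - z := by linear_combination hz'
      rw [this]
      module
    rw [this, Matrix.smul_mul, one_mul, Matrix.trace_smul, hρ.2]
    simp
  refine ⟨(2⁻¹ : ℂ) • ((1 + (-Complex.I) • P) * ρ * (1 + (-Complex.I) • P).conjTranspose),
    (2⁻¹ : ℂ) • ((1 + Complex.I • P) * ρ * (1 + Complex.I • P).conjTranspose),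
    (hρ.1.mul_mul_conjTranspose_same _).smul (by simp),
    (hρ.1.mul_mul_conjTranspose_same _).smul (by simp), ?_, ?_⟩
  · simp only [Matrix.conjTranspose_add, Matrix.conjTranspose_smul, Matrix.conjTranspose_one,
      hPh.eq, add_mul, mul_add, one_mul, mul_one, Matrix.smul_mul, Matrix.mul_smul, smul_smul,
      star_neg, Complex.star_def, Complex.conj_I, neg_neg]
    module
  · rw [hB _ (by simp) (by simp), hB _ (by simp) (by simp)]
    norm_num

/-- Two rotations by the same Pauli operator differ by at most twice the angle between them. -/
theorem absBound_evolve_sub_evolve {P ρ : QOp n} (hP : P * P = 1) (hPh : P.IsHermitian)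
    (hρ : IsMixedState ρ) (a b : ℝ) :
    AbsBound (conjBy (evolve a P) ρ - conjBy (evolve b P) ρ) (2 * |a - b|) := by
  -- Remove the common rotation by the mean angle: the opposite angles `±t` that remain differ by
  -- exactly `sin (2t)` times the commutator.
  have ha : evolve a P = evolve ((a + b) / 2) P * evolve ((a - b) / 2) P := by
    rw [← evolve_add_left]; congr 1; ring
  have hb : evolve b P = evolve ((a + b) / 2) P * evolve (-((a - b) / 2)) P := by
    rw [← evolve_add_left]; congr 1; ring
  rw [ha, hb, conjBy_mul, conjBy_mul, ← conjBy_sub]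
  refine AbsBound.conj ?_ (isUnitaryOp_evolve hPh _)
  set t := (a - b) / 2 with ht
  have e : conjBy (evolve t P) ρ - conjBy (evolve (-t) P) ρ =
      ((2 * Real.sin t * Real.cos t : ℝ) : ℂ) • (Complex.I • (ρ * P - P * ρ)) := by
    rw [conjBy, conjBy, evolve_conjTranspose hPh, evolve_conjTranspose hPh, neg_neg]
    simp only [evolve_involution hP, Real.cos_neg, Real.sin_neg, sub_mul, mul_sub,
      Matrix.smul_mul, Matrix.mul_smul, one_mul, mul_one, smul_smul]
    push_cast
    module
  rw [e, ← Real.sin_two_mul]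
  refine ((absBound_commutator hP hPh hρ).smul _).mono ?_
  rw [mul_comm]
  refine mul_le_mul_of_nonneg_left (Real.abs_sin_le_abs.trans (le_of_eq ?_)) zero_le_two
  rw [ht]; congr 1; ring

theorem vanishesOn_conjBy_sub {P : QOp n} (hPh : P.IsHermitian) (ρ : QOp n) (a b : ℝ) :
    VanishesOn (opSupport P) (conjBy (evolve a P) ρ - conjBy (evolve b P) ρ) := by
  intro O hO
  have hc : Commute O P := commute_of_actsTriviallyAt_opSupport hO
  have h : ∀ t, (O * conjBy (evolve t P) ρ).trace = (O * ρ).trace := fun t => by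
    rw [trace_mul_conjBy, mul_assoc _ O, (commute_evolve_right hc t).eq, ← mul_assoc,
      show _ = _ from isUnitaryOp_evolve hPh t, one_mul]
  rw [mul_sub, Matrix.trace_sub, h, h, sub_self]

/-! ### Light cones -/

/-- The unitary `U` enlarges a set of qubits to a light cone at most `Q` times as large. -/
structure Spreads (Q : ℕ) (U : QOp n) : Prop where
  isUnitaryOp : IsUnitaryOp U
  exists_cone : ∀ S : Finset (Fin n), ∃ S' : Finset (Fin n), S'.card ≤ Q * S.card ∧
    ∀ O : QOp n, (∀ i ∈ S', ActsTriviallyAt O i) →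
      ∀ i ∈ S, ActsTriviallyAt (U.conjTranspose * O * U) i

/-- Heisenberg picture: an observable trivial on the cone of `S` pulls back to one trivial on `S`,
on which `M` vanishes. -/
theorem Cost.conjBy {M : QOp n} {w : ℝ} (h : Cost M w) {Q : ℕ} {U : QOp n} (hU : Spreads Q U) :
    Cost (conjBy U M) (Q * w) := by
  induction h with
  | zero => simpa [QAnneal.conjBy] using Cost.zero
  | @base M t S hM hS =>
    obtain ⟨S', hcard, hS'⟩ := hU.exists_cone S
    refine (Cost.base (S := S') (hM.conj hU.isUnitaryOp) fun O hO => ?_).mono ?_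
    · rw [← QAnneal.conjBy, trace_mul_conjBy]
      exact hS _ (hS' O hO)
    · rw [← mul_assoc]
      exact mul_le_mul_of_nonneg_right (by exact_mod_cast hcard) hM.nonneg
  | sum _ _ ih ih' =>
    rw [conjBy_add, mul_add]
    exact ih.sum ih'
  | mono _ hvw ih => exact ih.mono (mul_le_mul_of_nonneg_left hvw Q.cast_nonneg)

/-- The union of `S` and of the edges in `E` that meet `S`. -/
def cone (E : Finset (Finset (Fin n))) (S : Finset (Fin n)) : Finset (Fin n) :=
  S.biUnion fun v => {v} ∪ (E.filter fun e => v ∈ e).biUnion id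

theorem card_cone_le {E : Finset (Finset (Fin n))} {d 𝔡 : ℕ} (hE : ∀ e ∈ E, e.card ≤ d)
    (hdeg : ∀ v, (E.filter fun e => v ∈ e).card ≤ 𝔡) (S : Finset (Fin n)) :
    (cone E S).card ≤ max 1 (d * 𝔡) * S.card := by
  rw [mul_comm]
  refine Finset.card_biUnion_le_card_mul _ _ _ fun v _ => ?_
  -- An isolated vertex contributes itself, whence the `max 1`; any other vertex already lies in its
  -- edges.
  by_cases h : (E.filter fun e => v ∈ e) = ∅
  · rw [h]; simp
  · obtain ⟨e, he⟩ := Finset.nonempty_iff_ne_empty.2 h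
    rw [Finset.union_eq_right.2]
    · refine le_max_of_le_right ?_
      refine (Finset.card_biUnion_le_card_mul _ _ d fun e he => ?_).trans ?_
      · exact hE e (Finset.mem_filter.1 he).1
      · rw [mul_comm]; exact Nat.mul_le_mul_left d (hdeg v)
    · rw [Finset.singleton_subset_iff, Finset.mem_biUnion]
      exact ⟨e, he, (Finset.mem_filter.1 he).2⟩

theorem spreads_evolve_sum {ι : Type*} (s : Finset ι) {A : ι → QOp n}
    (hA : ∀ k ∈ s, (A k).IsHermitian) (hcomm : ∀ k ∈ s, ∀ l ∈ s, Commute (A k) (A l))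
    {E : Finset (Finset (Fin n))} {d 𝔡 : ℕ} (hE : ∀ e ∈ E, e.card ≤ d)
    (hdeg : ∀ v, (E.filter fun e => v ∈ e).card ≤ 𝔡)
    (hAE : ∀ k ∈ s, ∃ e ∈ E, opSupport (A k) ⊆ e) (t : ℝ) :
    Spreads (max 1 (d * 𝔡)) (evolve t (∑ k ∈ s, A k)) := by
  classical
  have hsum : ∀ u ⊆ s, (∑ k ∈ u, A k).IsHermitian := fun u hu => by
    rw [Matrix.IsHermitian, Matrix.conjTranspose_sum]
    exact Finset.sum_congr rfl fun k hk => hA k (hu hk)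
  refine ⟨isUnitaryOp_evolve (hsum s subset_rfl) t,
    fun S => ⟨cone E S, card_cone_le hE hdeg S, fun O hO i hi => ?_⟩⟩
  -- The terms meeting `S` live inside the cone, commute with `O` and cancel; the other terms do not
  -- touch `S`. Commutativity factors the exponential accordingly.
  set s₁ := s.filter fun k => ∃ v ∈ S, v ∈ opSupport (A k)
  set s₂ := s.filter fun k => ¬ ∃ v ∈ S, v ∈ opSupport (A k)
  have hs₁ : s₁ ⊆ s := Finset.filter_subset _ _
  have hs₂ : s₂ ⊆ s := Finset.filter_subset _ _
  have h12 : Commute (∑ k ∈ s₁, A k) (∑ k ∈ s₂, A k) :=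
    Commute.sum_left _ _ _ fun k hk => Commute.sum_right _ _ _ fun l hl =>
      hcomm k (hs₁ hk) l (hs₂ hl)
  have hO₁ : Commute O (∑ k ∈ s₁, A k) := by
    refine Commute.sum_right _ _ _ fun k hk => commute_of_actsTriviallyAt_opSupport fun j hj => ?_
    obtain ⟨hks, v, hv, hvk⟩ := Finset.mem_filter.1 hk
    obtain ⟨e, he, hke⟩ := hAE k hks
    refine hO j (Finset.mem_biUnion.2 ⟨v, hv, Finset.mem_union_right _ ?_⟩)
    exact Finset.mem_biUnion.2 ⟨e, Finset.mem_filter.2 ⟨he, hke hvk⟩, hke hj⟩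
  have h₂ : ActsTriviallyAt (∑ k ∈ s₂, A k) i := by
    refine ActsTriviallyAt.sum fun k hk => actsTriviallyAt_of_notMem_opSupport fun hik => ?_
    exact (Finset.mem_filter.1 hk).2 ⟨i, hi, hik⟩
  have hev : ∀ r, ActsTriviallyAt (evolve r (∑ k ∈ s₂, A k)) i := fun r => by
    rw [actsTriviallyAt_iff_commute] at h₂ ⊢
    exact fun k => (commute_evolve_right (h₂ k).symm r).symm
  have hOi : ActsTriviallyAt O i :=
    hO i (Finset.mem_biUnion.2 ⟨i, hi, by simp⟩)
  rw [← Finset.sum_filter_add_sum_filter_not s (fun k => ∃ v ∈ S, v ∈ opSupport (A k))]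
  have hU := isUnitaryOp_evolve (hsum s₁ hs₁) t
  have e : (evolve t (∑ k ∈ s₁, A k + ∑ k ∈ s₂, A k)).conjTranspose * O *
      evolve t (∑ k ∈ s₁, A k + ∑ k ∈ s₂, A k) =
      evolve (-t) (∑ k ∈ s₂, A k) * O * evolve t (∑ k ∈ s₂, A k) := by
    rw [evolve_add h12, Matrix.conjTranspose_mul, evolve_conjTranspose (hsum s₂ hs₂)]
    simp only [mul_assoc]
    congr 1
    rw [← mul_assoc O, (commute_evolve_right hO₁ t).eq, ← mul_assoc, ← mul_assoc,
      show _ = _ from hU, one_mul]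
  rw [e]
  exact ((hev _).mul hOi).mul (hev _)

/-! ### Propagation of differences through two circuits -/

/-- Passing two states through `U` and `V` multiplies the cost of their difference by at most `Q`
and adds at most `Q * b`. -/
structure Near (Q : ℕ) (b : ℝ) (U V : QOp n) : Prop where
  left : IsUnitaryOp U
  right : IsUnitaryOp V
  cost : ∀ ρ σ : QOp n, IsMixedState ρ → IsMixedState σ → ∀ w : ℝ, Cost (ρ - σ) w →
    Cost (conjBy U ρ - conjBy V σ) (Q * (w + b))

theorem near_one : Near 1 0 (1 : QOp n) 1 :=
  ⟨isUnitaryOp_one, isUnitaryOp_one, fun ρ σ _ _ w h => by simpa [conjBy_one] using h⟩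

/-- Split `UρU† - VσV†` as `V(ρ - σ)V† + (UρU† - VρV†)`; only `V` needs a light cone. -/
theorem Spreads.near {Q : ℕ} {U V : QOp n} (hU : IsUnitaryOp U) (hV : Spreads Q V) {b : ℝ}
    (h : ∀ ρ, IsMixedState ρ → Cost (conjBy U ρ - conjBy V ρ) (Q * b)) : Near Q b U V := by
  refine ⟨hU, hV.isUnitaryOp, fun ρ σ hρ _ w hw => ?_⟩
  have := (hw.conjBy hV).sum (h ρ hρ)
  rw [conjBy_sub, ← mul_add] at this
  convert this using 1
  abel

theorem Near.mul {Q Q' : ℕ} {b b' : ℝ} {U V U' V' : QOp n} (h : Near Q b U V)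
    (h' : Near Q' b' U' V') (hQ : 1 ≤ Q) (hb' : 0 ≤ b') :
    Near (Q' * Q) (b + b') (U' * U) (V' * V) := by
  refine ⟨h'.left.mul h.left, h'.right.mul h.right, fun ρ σ hρ hσ w hw => ?_⟩
  rw [conjBy_mul, conjBy_mul]
  refine (h'.cost _ _ (hρ.conjBy h.left) (hσ.conjBy h.right) _ (h.cost ρ σ hρ hσ w hw)).mono ?_
  have h1 : b' ≤ Q * b' := le_mul_of_one_le_left hb' (by exact_mod_cast hQ)
  rw [Nat.cast_mul, mul_assoc]
  refine mul_le_mul_of_nonneg_left ?_ Q'.cast_nonneg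
  linarith

theorem near_prod_ofFn {Q : ℕ} (hQ : 1 ≤ Q) : ∀ {k : ℕ} {U V : Fin k → QOp n} {b : Fin k → ℝ},
    (∀ i, 0 ≤ b i) → (∀ i, Near Q (b i) (U i) (V i)) →
    Near (Q ^ k) (∑ i, b i) (List.ofFn U).reverse.prod (List.ofFn V).reverse.prod
  | 0, _, _, _, _, _ => by simpa using near_one
  | k + 1, U, V, b, hb, h => by
    rw [List.ofFn_succ', List.ofFn_succ', List.concat_eq_append, List.concat_eq_append,
      List.reverse_append, List.reverse_append, List.prod_append, List.prod_append,
      Fin.sum_univ_castSucc, pow_succ']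
    simpa using (near_prod_ofFn hQ (fun i => hb i.castSucc) fun i => h i.castSucc).mul
      (h (Fin.last k)) (Nat.one_le_pow _ _ hQ) (hb _)

variable {D K p : ℕ}

/-! ### The cost evolutions -/

theorem commute_pauli_of_commute_costTerm {x : Fin D → Fin n → Fin 4} {part : Fin D → Fin K}
    (hcomm : ∀ (i : Fin K) (X Y : Fin D → ℝ),
      Commute (costTerm x part i X) (costTerm x part i Y)) {j k : Fin D} (hjk : part j = part k) :
    Commute (pauli (x j)) (pauli (x k)) := by
  have hZ : 0 < costZ part := by
    refine Finset.sum_pos' (fun _ _ => Nat.zero_le _) ⟨part j, Finset.mem_univ _, ?_⟩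
    exact Finset.card_pos.2 ⟨j, by simp [costIndex]⟩
  have hc : ((1 / Real.sqrt (costZ part) : ℝ) : ℂ) ≠ 0 := by
    have : 0 < Real.sqrt (costZ part) := Real.sqrt_pos.2 (by exact_mod_cast hZ)
    exact_mod_cast (one_div_pos.2 this).ne'
  have h : ∀ l, part l = part j → costTerm x part (part j) (Pi.single l 1) =
      ((1 / Real.sqrt (costZ part) : ℝ) : ℂ) • pauli (x l) := by
    intro l hl
    rw [costTerm, Finset.sum_eq_single l]
    · simp
    · intro m _ hm; simp [hm]
    · intro h; exact absurd (by simp [costIndex, hl]) h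
  -- Indicator coefficients isolate the two Pauli operators.
  have := hcomm (part j) (Pi.single j 1) (Pi.single k 1)
  rw [h j rfl, h k hjk.symm] at this
  exact (Commute.smul_left_iff₀ hc).1 ((Commute.smul_right_iff₀ hc).1 this)

theorem isHermitian_sum_pauli (x : Fin D → Fin n → Fin 4) (s : Finset (Fin D))
    (c : Fin D → ℝ) :
    (∑ j ∈ s, (c j : ℂ) • pauli (x j)).IsHermitian := by
  rw [Matrix.IsHermitian, Matrix.conjTranspose_sum]
  refine Finset.sum_congr rfl fun j _ => ?_
  rw [Matrix.conjTranspose_smul, (pauli_isHermitian _).eq]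
  simp

/-- Changing the coefficients of commuting Pauli operators one at a time. -/
theorem cost_evolve_sum_pauli (x : Fin D → Fin n → Fin 4) (t : ℝ) (X Y : Fin D → ℝ)
    (s : Finset (Fin D)) (hcomm : ∀ j ∈ s, ∀ k ∈ s, Commute (pauli (x j)) (pauli (x k))) :
    ∀ ρ : QOp n, IsMixedState ρ →
      Cost (conjBy (evolve t (∑ j ∈ s, (X j : ℂ) • pauli (x j))) ρ -
        conjBy (evolve t (∑ j ∈ s, (Y j : ℂ) • pauli (x j))) ρ)
        (∑ j ∈ s, (opSupport (pauli (x j))).card * (2 * |t * X j - t * Y j|)) := by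
  induction s using Finset.induction_on with
  | empty => intro ρ _; simpa using Cost.zero
  | insert j s hj ih =>
    intro ρ hρ
    -- By commutativity the rotation being changed can act last, so no light cone is paid within a
    -- group; the intermediate circuit has `Y` at `j` and `X` on `s`.
    have hjs : ∀ c e : Fin D → ℝ,
        Commute ((c j : ℂ) • pauli (x j)) (∑ k ∈ s, (e k : ℂ) • pauli (x k)) := fun c e =>
      Commute.sum_right _ _ _ fun k hk =>
        ((hcomm j (by simp) k (by simp [hk])).smul_left _).smul_right _
    have hU := isUnitaryOp_evolve (isHermitian_sum_pauli x s X) t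
    have hV : IsUnitaryOp (evolve (t * Y j) (pauli (x j))) :=
      isUnitaryOp_evolve (pauli_isHermitian _) _
    have h1 := Cost.base
      (absBound_evolve_sub_evolve (pauli_mul_self (x j)) (pauli_isHermitian (x j))
        (hρ.conjBy hU) (t * X j) (t * Y j))
      (vanishesOn_conjBy_sub (pauli_isHermitian (x j)) _ _ _)
    have h2 := ih (fun k hk l hl => hcomm k (by simp [hk]) l (by simp [hl])) _ (hρ.conjBy hV)
    have h3 := h1.sum h2
    rw [Finset.sum_insert hj, Finset.sum_insert hj, Finset.sum_insert hj, evolve_add (hjs X X),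
      evolve_add (hjs Y Y), (commute_evolve (hjs Y Y) t t).eq, conjBy_mul, conjBy_mul,
      evolve_mul, evolve_mul]
    convert h3 using 1
    rw [← conjBy_mul (evolve (t * Y j) (pauli (x j))), ← evolve_mul, ← evolve_mul,
      (commute_evolve (hjs Y X) t t).eq, conjBy_mul]
    abel

theorem evolve_costTerm (x : Fin D → Fin n → Fin 4) (part : Fin D → Fin K) (i : Fin K)
    (X : Fin D → ℝ) (t : ℝ) :
    evolve t (costTerm x part i X) = evolve (t * (1 / Real.sqrt (costZ part)))
      (∑ j ∈ costIndex part i, (X j : ℂ) • pauli (x j)) :=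
  evolve_mul _ _ _

theorem card_opSupport_pauli_le {x : Fin D → Fin n → Fin 4} {d 𝔡 : ℕ}
    (hlocal : ∀ j, pauliWeight (x j) ≤ d) {X : Fin D → ℝ}
    (hX : DegreeLE (fun j => (X j : ℂ) • pauli (x j)) 𝔡) {j : Fin D} (hj : X j ≠ 0) :
    (opSupport (pauli (x j))).card ≤ d * 𝔡 := by
  have hd := (opSupport_pauli_card_le (x j)).trans (hlocal j)
  rcases (opSupport (pauli (x j))).eq_empty_or_nonempty with h | ⟨v, hv⟩
  · simp [h]
  · have : 1 ≤ 𝔡 := by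
      refine le_trans (Finset.card_pos.2 ⟨opSupport (pauli (x j)), ?_⟩) (hX v)
      refine Finset.mem_filter.2 ⟨Finset.mem_image.2 ⟨j, Finset.mem_univ _, ?_⟩, hv⟩
      exact opSupport_smul (by exact_mod_cast hj) _
    exact hd.trans (Nat.le_mul_of_pos_right d this)

theorem spreads_costTerm {x : Fin D → Fin n → Fin 4} {part : Fin D → Fin K} {d 𝔡 : ℕ}
    (hlocal : ∀ j, pauliWeight (x j) ≤ d)
    (hcomm : ∀ j k, part j = part k → Commute (pauli (x j)) (pauli (x k))) {X : Fin D → ℝ}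
    (hX : DegreeLE (fun j => (X j : ℂ) • pauli (x j)) 𝔡) (i : Fin K) (t : ℝ) :
    Spreads (max 1 (d * 𝔡)) (evolve t (costTerm x part i X)) := by
  rw [evolve_costTerm]
  refine spreads_evolve_sum _ (fun k _ => ?_) (fun k hk l hl => ?_)
    (E := hyperedges fun j => (X j : ℂ) • pauli (x j)) (fun e he => ?_) hX (fun k _ => ?_) _
  · simpa using isHermitian_sum_pauli x {k} X
  · refine ((hcomm k l ?_).smul_left _).smul_right _
    simp only [costIndex, Finset.mem_filter] at hk hl
    rw [hk.2, hl.2]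
  · obtain ⟨j, -, rfl⟩ := Finset.mem_image.1 he
    exact (Finset.card_le_card (opSupport_smul_subset _ _)).trans
      ((opSupport_pauli_card_le (x j)).trans (hlocal j))
  · exact ⟨_, Finset.mem_image_of_mem _ (Finset.mem_univ k), subset_rfl⟩

theorem IsCommutingLocal.spreads {d 𝔡 : ℕ} {H : QOp n} (h : IsCommutingLocal d 𝔡 H) (t : ℝ) :
    Spreads (max 1 (d * 𝔡)) (evolve t H) := by
  obtain ⟨m, A, rfl, hA, hd, hc, hdeg⟩ := h
  refine spreads_evolve_sum _ (fun k _ => hA k) (fun k _ l _ => hc k l) (E := hyperedges A)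
    (fun e he => ?_) hdeg (fun k _ => ⟨_, Finset.mem_image_of_mem _ (Finset.mem_univ k),
      subset_rfl⟩) _
  obtain ⟨j, -, rfl⟩ := Finset.mem_image.1 he
  exact hd j

/-! ### The annealing circuit -/

theorem near_costTerm {x : Fin D → Fin n → Fin 4} {part : Fin D → Fin K} {d 𝔡 : ℕ}
    (hZ : n ≤ costZ part) (hlocal : ∀ j, pauliWeight (x j) ≤ d)
    (hcomm : ∀ j k, part j = part k → Commute (pauli (x j)) (pauli (x k))) {X Y : Fin D → ℝ}
    (hX : DegreeLE (fun j => (X j : ℂ) • pauli (x j)) 𝔡)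
    (hY : DegreeLE (fun j => (Y j : ℂ) • pauli (x j)) 𝔡) (i : Fin K) {t θ : ℝ} (ht : |t| ≤ θ) :
    Near (max 1 (d * 𝔡))
      ((min 1 (d * 𝔡) : ℕ) * (2 * (θ / n) * ∑ j ∈ costIndex part i, |X j - Y j|))
      (evolve (t / Real.sqrt n) (costTerm x part i X))
      (evolve (t / Real.sqrt n) (costTerm x part i Y)) := by
  refine Spreads.near (spreads_costTerm hlocal hcomm hX i _).isUnitaryOp
    (spreads_costTerm hlocal hcomm hY i _) fun ρ hρ => ?_
  rw [evolve_costTerm, evolve_costTerm]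
  refine (cost_evolve_sum_pauli x _ X Y _ (fun j hj k hk => hcomm j k ?_) ρ hρ).mono ?_
  · simp only [costIndex, Finset.mem_filter] at hj hk
    rw [hj.2, hk.2]
  -- `max 1 m * min 1 m = m`: the factor `min` makes the bound exactly `d𝔡` per changed term, also
  -- when `d𝔡 = 0`.
  rw [← mul_assoc, ← Nat.cast_mul, max_mul_min, one_mul, Finset.mul_sum, Finset.mul_sum]
  refine Finset.sum_le_sum fun j _ => ?_
  by_cases hj : X j = Y j
  · simp [hj]
  have hcard : (opSupport (pauli (x j))).card ≤ d * 𝔡 := by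
    by_cases h : X j = 0
    · exact card_opSupport_pauli_le hlocal hY fun h' => hj (h.trans h'.symm)
    · exact card_opSupport_pauli_le hlocal hX h
  refine mul_le_mul (by exact_mod_cast hcard) ?_ (by positivity) (Nat.cast_nonneg _)
  rw [← mul_sub, abs_mul, mul_assoc 2]
  refine mul_le_mul_of_nonneg_left (mul_le_mul_of_nonneg_right ?_ (abs_nonneg _)) zero_le_two
  rw [div_mul_div_comm, mul_one, abs_div, abs_of_nonneg (a := Real.sqrt n * _) (by positivity)]
  rcases Nat.eq_zero_or_pos n with hn | hn
  · simp [hn]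
  · have hn' : (0 : ℝ) < n := Nat.cast_pos.2 hn
    refine div_le_div₀ ((abs_nonneg t).trans ht) ht hn' ?_
    calc (n : ℝ) = Real.sqrt n * Real.sqrt n := (Real.mul_self_sqrt hn'.le).symm
      _ ≤ _ := mul_le_mul_of_nonneg_left (Real.sqrt_le_sqrt (by exact_mod_cast hZ))
          (Real.sqrt_nonneg _)

theorem near_annealCircuit {x : Fin D → Fin n → Fin 4} {part : Fin D → Fin K} {d 𝔡 : ℕ}
    (hZ : n ≤ costZ part) (hlocal : ∀ j, pauliWeight (x j) ≤ d)
    (hcomm : ∀ j k, part j = part k → Commute (pauli (x j)) (pauli (x k))) {X Y : Fin D → ℝ}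
    (hX : DegreeLE (fun j => (X j : ℂ) • pauli (x j)) 𝔡)
    (hY : DegreeLE (fun j => (Y j : ℂ) • pauli (x j)) 𝔡)
    {HM : QOp n} (hHM : IsCommutingLocal d 𝔡 HM) (β : Fin p → ℝ) (γ : Fin p → Fin K → ℝ) :
    Near ((max 1 (d * 𝔡)) ^ ((K + 1) * p))
      (p * ((min 1 (d * 𝔡) : ℕ) * (2 * (‖(β, γ)‖ / n) * ∑ j, |X j - Y j|)))
      (annealCircuit (fun i => costTerm x part i X) HM β γ)
      (annealCircuit (fun i => costTerm x part i Y) HM β γ) := by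
  have hγ : ∀ l i, |γ l i| ≤ ‖(β, γ)‖ := fun l i =>
    ((norm_le_pi_norm (γ l) i).trans (norm_le_pi_norm γ l)).trans (le_max_right _ _)
  have hQ : 1 ≤ max 1 (d * 𝔡) := le_max_left _ _
  have hlayer : ∀ l, Near ((max 1 (d * 𝔡)) ^ (K + 1))
      ((min 1 (d * 𝔡) : ℕ) * (2 * (‖(β, γ)‖ / n) * ∑ j, |X j - Y j|))
      (annealLayer (fun i => costTerm x part i X) HM (β l) (γ l))
      (annealLayer (fun i => costTerm x part i Y) HM (β l) (γ l)) := by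
    intro l
    have h1 := near_prod_ofFn hQ
      (fun i => by positivity) (fun i => near_costTerm hZ hlocal hcomm hX hY i (hγ l i))
    have h2 : Near (max 1 (d * 𝔡)) 0 (evolve (β l) HM) (evolve (β l) HM) :=
      Spreads.near (hHM.spreads _).isUnitaryOp (hHM.spreads _) fun ρ _ => by
        simpa using Cost.zero
    have h3 := h1.mul h2 (Nat.one_le_pow _ _ hQ) le_rfl
    have hsum : ∑ i : Fin K, ∑ j ∈ costIndex part i, |X j - Y j| = ∑ j, |X j - Y j| :=
      Finset.sum_fiberwise _ _ _
    rw [← pow_succ', add_zero, ← Finset.mul_sum, ← Finset.mul_sum, hsum] at h3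
    exact h3
  have h := near_prod_ofFn (Nat.one_le_pow _ _ hQ) (fun _ => by positivity) hlayer
  rw [Finset.sum_const, Finset.card_univ, Fintype.card_fin, nsmul_eq_mul, ← pow_mul] at h
  exact h

theorem annealing_eq_conjBy {Ω : Type*} (HC : Fin K → (Fin D → ℝ) → QOp n) (HM : Ω → QOp n)
    (β : Fin p → ℝ) (γ : Fin p → Fin K → ℝ) (ψ₀ : Ω → (Fin n → Fin 2) → ℂ)
    (X : Fin D → ℝ) (ω : Ω) :
    annealing HC HM β γ ψ₀ X ω = conjBy (annealCircuit (fun i => HC i X) (HM ω) β γ)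
      (Matrix.vecMulVec (ψ₀ ω) (star (ψ₀ ω))) := by
  rw [annealing, conjBy, Matrix.mul_vecMulVec, Matrix.vecMulVec_mul, Matrix.star_mulVec]

theorem IsUnitaryOp.list_prod {l : List (QOp n)} (h : ∀ U ∈ l, IsUnitaryOp U) :
    IsUnitaryOp l.prod := by
  induction l with
  | nil => simpa using isUnitaryOp_one
  | cons U l ih =>
    rw [List.prod_cons]
    exact (h U (by simp)).mul (ih fun V hV => h V (by simp [hV]))

theorem isUnitaryOp_annealCircuit {HC : Fin K → QOp n} {HM : QOp n}
    (hHC : ∀ i, (HC i).IsHermitian) (hHM : HM.IsHermitian) (β : Fin p → ℝ)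
    (γ : Fin p → Fin K → ℝ) : IsUnitaryOp (annealCircuit HC HM β γ) := by
  refine IsUnitaryOp.list_prod fun U hU => ?_
  obtain ⟨l, rfl⟩ := List.mem_ofFn.1 (List.mem_reverse.1 hU)
  refine (isUnitaryOp_evolve hHM _).mul (IsUnitaryOp.list_prod fun V hV => ?_)
  obtain ⟨i, rfl⟩ := List.mem_ofFn.1 (List.mem_reverse.1 hV)
  exact isUnitaryOp_evolve (hHC i) _

theorem costTerm_isHermitian (x : Fin D → Fin n → Fin 4) (part : Fin D → Fin K) (i : Fin K)
    (X : Fin D → ℝ) : (costTerm x part i X).IsHermitian := by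
  rw [costTerm, Matrix.IsHermitian, Matrix.conjTranspose_smul,
    (isHermitian_sum_pauli x _ X).eq, Complex.star_def, Complex.conj_ofReal]

theorem IsCommutingLocal.isHermitian {d 𝔡 : ℕ} {H : QOp n} (h : IsCommutingLocal d 𝔡 H) :
    H.IsHermitian := by
  obtain ⟨m, A, rfl, hA, -⟩ := h
  rw [Matrix.IsHermitian, Matrix.conjTranspose_sum]
  exact Finset.sum_congr rfl fun k _ => hA k

theorem isMixedState_vecMulVec {ψ : (Fin n → Fin 2) → ℂ} (h : ∑ a, ‖ψ a‖ ^ 2 = 1) :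
    IsMixedState (Matrix.vecMulVec ψ (star ψ)) := by
  refine ⟨Matrix.posSemidef_vecMulVec_self_star ψ, ?_⟩
  have : ∀ a, ψ a * star (ψ a) = ((‖ψ a‖ ^ 2 : ℝ) : ℂ) := fun a => by
    rw [Complex.star_def, Complex.mul_conj, Complex.normSq_eq_norm_sq]
  simp only [Matrix.trace, Matrix.diag, Matrix.vecMulVec_apply, Pi.star_apply, this]
  rw [← Complex.ofReal_sum, h, Complex.ofReal_one]

theorem three_halves_mul_sqrt_two_le {K p : ℕ} (hK : 0 < K) :
    3 / 2 * (p : ℝ) * Real.sqrt 2 ≤ (3 / 2) ^ ((K + 1) * p) := by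
  have h2 : Real.sqrt 2 ≤ 3 / 2 := by
    rw [Real.sqrt_le_left (by norm_num)]; norm_num
  -- As `K ≥ 1`, at least `2p` factors `3/2` are available.
  have h1 : (3 / 2 * 3 / 2 : ℝ) * p ≤ (9 / 4) ^ p := by
    induction p with
    | zero => simp
    | succ p ih =>
      rcases Nat.eq_zero_or_pos p with rfl | hp
      · norm_num
      · have : (1 : ℝ) ≤ p := by exact_mod_cast hp
        rw [pow_succ]; push_cast; nlinarith
  calc 3 / 2 * (p : ℝ) * Real.sqrt 2 ≤ 3 / 2 * (p : ℝ) * (3 / 2) :=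
        mul_le_mul_of_nonneg_left h2 (by positivity)
    _ ≤ (9 / 4) ^ p := by linarith
    _ = (3 / 2) ^ (2 * p) := by rw [pow_mul]; norm_num
    _ ≤ _ := pow_le_pow_right₀ (by norm_num) (Nat.mul_le_mul_right p (by omega))

theorem stability_constant_le (n d 𝔡 : ℕ) {K p : ℕ} (hK : 0 < K) {θ : ℝ} (hθ : 0 ≤ θ) :
    3 / 16 * Real.sqrt n * (((max 1 (d * 𝔡)) ^ ((K + 1) * p) : ℕ) *
      (p * ((min 1 (d * 𝔡) : ℕ) * (2 * (θ / n))))) ≤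
      θ / (4 * Real.sqrt (2 * n)) * (3 / 2 * d * 𝔡) ^ ((K + 1) * p) := by
  have hq : (((max 1 (d * 𝔡)) ^ ((K + 1) * p) : ℕ) : ℝ) * (p * (min 1 (d * 𝔡) : ℕ)) ≤
      p * ((d * 𝔡 : ℕ) : ℝ) ^ ((K + 1) * p) := by
    rcases Nat.eq_zero_or_pos (d * 𝔡) with h | h
    · rw [h]; simp; positivity
    · rw [max_eq_right h, min_eq_left h]; simp [mul_comm]
  have hs : Real.sqrt n * (θ / n) = θ / Real.sqrt n := by
    rw [mul_div_assoc', mul_comm, mul_div_assoc, Real.sqrt_div_self', mul_one_div]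
  have h2 : θ / (4 * Real.sqrt (2 * n)) = θ / Real.sqrt n / (4 * Real.sqrt 2) := by
    rw [Real.sqrt_mul zero_le_two, div_div]; congr 1; ring
  have h3 := three_halves_mul_sqrt_two_le (p := p) hK
  have hθn : 0 ≤ θ / Real.sqrt n := by positivity
  have hs2 : 0 < Real.sqrt 2 := by positivity
  calc _ = 3 / 8 * (Real.sqrt n * (θ / n)) * ((((max 1 (d * 𝔡)) ^ ((K + 1) * p) : ℕ) : ℝ) *
        (p * (min 1 (d * 𝔡) : ℕ))) := by ring
    _ ≤ 3 / 8 * (θ / Real.sqrt n) * (p * ((d * 𝔡 : ℕ) : ℝ) ^ ((K + 1) * p)) := by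
        rw [hs]; exact mul_le_mul_of_nonneg_left hq (by positivity)
    _ = θ / Real.sqrt n / (4 * Real.sqrt 2) * ((3 / 2 * (p : ℝ) * Real.sqrt 2) *
        ((d * 𝔡 : ℕ) : ℝ) ^ ((K + 1) * p)) := by field_simp; ring
    _ ≤ θ / Real.sqrt n / (4 * Real.sqrt 2) * ((3 / 2) ^ ((K + 1) * p) *
        ((d * 𝔡 : ℕ) : ℝ) ^ ((K + 1) * p)) := by gcongr
    _ = _ := by rw [h2, ← mul_pow, Nat.cast_mul, mul_assoc (3 / 2 : ℝ)]

theorem wassersteinNorm_annealing_sub_le {Ω : Type*} {x : Fin D → Fin n → Fin 4}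
    {part : Fin D → Fin K} {d 𝔡 : ℕ}
    (hZ : n ≤ costZ part) (hlocal : ∀ j, pauliWeight (x j) ≤ d)
    (hcomm : ∀ j k, part j = part k → Commute (pauli (x j)) (pauli (x k)))
    {HM : Ω → QOp n} (hHM : ∀ ω, IsCommutingLocal d 𝔡 (HM ω))
    {ψ₀ : Ω → (Fin n → Fin 2) → ℂ} (hψ₀ : ∀ ω, ∑ a, ‖ψ₀ ω a‖ ^ 2 = 1)
    (β : Fin p → ℝ) (γ : Fin p → Fin K → ℝ) {X Y : Fin D → ℝ}
    (hX : DegreeLE (fun j => (X j : ℂ) • pauli (x j)) 𝔡)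
    (hY : DegreeLE (fun j => (Y j : ℂ) • pauli (x j)) 𝔡) (ω : Ω) :
    wassersteinNorm 2 (annealing (costTerm x part) HM β γ ψ₀ X ω -
        annealing (costTerm x part) HM β γ ψ₀ Y ω) ≤
      Real.sqrt n + lambdaP n d 𝔡 β γ * ∑ j, |X j - Y j| := by
  have hρ := isMixedState_vecMulVec (hψ₀ ω)
  have h := (near_annealCircuit hZ hlocal hcomm hX hY (hHM ω) β γ).cost _ _ hρ hρ 0
    (by simpa using Cost.zero)
  rw [← annealing_eq_conjBy, ← annealing_eq_conjBy, zero_add] at h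
  refine h.wassersteinNorm_le.trans (add_le_add_right ?_ _)
  -- With no groups there are no cost terms, and both sums over `Fin D` are empty.
  rcases Nat.eq_zero_or_pos K with rfl | hK
  · have : IsEmpty (Fin D) := ⟨fun j => (part j).elim0⟩
    simp
  · refine le_trans (le_of_eq ?_) (mul_le_mul_of_nonneg_right
      (stability_constant_le n d 𝔡 (p := p) hK (norm_nonneg (β, γ)))
      (Finset.sum_nonneg fun j _ => abs_nonneg (X j - Y j)))
    ring

/-! ### The degree of the sparse disorder -/

/-- A factor `J j` either keeps the support or empties it, and an empty hyperedge contains no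
vertex. -/
theorem degreeLE_smul_mul {H : Fin D → QOp n} {𝔡 : ℕ} {S : Fin D → ℝ}
    (hS : DegreeLE (fun j => (S j : ℂ) • H j) 𝔡) (J : Fin D → ℝ) :
    DegreeLE (fun j => ((S j * J j : ℝ) : ℂ) • H j) 𝔡 := by
  refine fun v => (Finset.card_le_card fun e he => ?_).trans (hS v)
  obtain ⟨he, hv⟩ := Finset.mem_filter.1 he
  obtain ⟨j, -, rfl⟩ := Finset.mem_image.1 he
  refine Finset.mem_filter.2 ⟨Finset.mem_image.2 ⟨j, Finset.mem_univ _, ?_⟩, hv⟩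
  rcases eq_or_ne (J j) 0 with hJ | hJ
  · simp [hJ, opSupport_zero] at hv
  · dsimp only
    rw [mul_comm (S j), Complex.ofReal_mul, mul_smul,
      opSupport_smul (c := (J j : ℂ)) (by exact_mod_cast hJ)]

theorem measurableSet_degreeLE (H : Fin D → QOp n) (𝔡 : ℕ) :
    MeasurableSet {S : Fin D → ℝ | DegreeLE (fun j => (S j : ℂ) • H j) 𝔡} := by
  have hf : Measurable fun (S : Fin D → ℝ) (j : Fin D) => (S j ≠ 0 : Prop) := by
    refine measurable_pi_iff.2 fun j => measurableSet_setOfPred.1 ?_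
    exact (measurableSet_eq_fun (measurable_pi_apply j)
      (measurable_const (a := (0 : ℝ)))).compl
  -- The event depends only on which coordinates vanish, a measurable map into a finite space.
  have e : {S : Fin D → ℝ | DegreeLE (fun j => (S j : ℂ) • H j) 𝔡} =
      (fun (S : Fin D → ℝ) (j : Fin D) => (S j ≠ 0 : Prop)) ⁻¹'
        {q | DegreeLE (Set.indicator {j | q j} H) 𝔡} := by
    ext S
    have h : hyperedges (fun j => (S j : ℂ) • H j) =
        hyperedges (Set.indicator {j | S j ≠ 0} H) := by
      refine Finset.image_congr fun j _ => ?_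
      by_cases hj : S j = 0
      · simp [hj]
      · rw [Set.indicator_of_mem (show j ∈ {j | S j ≠ 0} from hj)]
        exact opSupport_smul (by exact_mod_cast hj) _
    change DegreeLE _ _ ↔ DegreeLE _ _
    unfold DegreeLE
    rw [h]
  rw [e]
  exact hf (Set.toFinite _).measurableSet

theorem ae_degreeLE_sparseDisorder (H : Fin D → QOp n) (s : unitInterval) (𝔡 : ℕ) :
    ∀ᵐ X ∂(sparseDisorder H s 𝔡), DegreeLE (fun j => (X j : ℂ) • H j) 𝔡 := by
  have hm : Measurable fun (z : (Fin D → ℝ) × (Fin D → ℝ)) j => z.1 j * z.2 j := by fun_prop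
  rw [sparseDisorder, ae_map_iff hm.aemeasurable (measurableSet_degreeLE H 𝔡)]
  have h : ∀ᵐ S ∂(cond (Measure.pi fun _ : Fin D => bernoulliMeasure (1 : ℝ) 0 s)
      {S | DegreeLE (fun j => (S j : ℂ) • H j) 𝔡}), DegreeLE (fun j => (S j : ℂ) • H j) 𝔡 :=
    ae_cond_mem (measurableSet_degreeLE H 𝔡)
  filter_upwards [Measure.quasiMeasurePreserving_fst.ae h] with z hz
  exact degreeLE_smul_mul hz z.2

end QAnneal

theorem mainTheorem9 {Ω : Type*} [MeasurableSpace Ω] (P : MeasureTheory.Measure Ω)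
    [MeasureTheory.IsProbabilityMeasure P] (n D K p d 𝔡 : ℕ) (s : unitInterval)
    (x : Fin D → Fin n → Fin 4) (part : Fin D → Fin K)
    (hZ : n ≤ costZ part)
    (hlocal : ∀ j, pauliWeight (x j) ≤ d)
    (hcomm : ∀ (i : Fin K) (X Y : Fin D → ℝ), Commute (costTerm x part i X) (costTerm x part i Y))
    (HM : Ω → QOp n) (hHM : ∀ ω, IsCommutingLocal d 𝔡 (HM ω))
    (ψ₀ : Ω → (Fin n → Fin 2) → ℂ) (hψ₀ : ∀ ω, ∑ a, ‖ψ₀ ω a‖ ^ 2 = 1)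
    (β : Fin p → ℝ) (γ : Fin p → Fin K → ℝ) :
    IsStableAlgorithm P (fun j => pauli (x j)) s (annealing (costTerm x part) HM β γ ψ₀)
      (Real.sqrt n) (lambdaP n d 𝔡 β γ) 𝔡 (Set.Icc 0 1) 0 := by
  have hc := fun j k => commute_pauli_of_commute_costTerm hcomm (j := j) (k := k)
  refine ⟨fun X ω => ?_, fun κ _ μ hμ => ?_⟩
  · rw [annealing_eq_conjBy]
    exact (isMixedState_vecMulVec (hψ₀ ω)).conjBy
      (isUnitaryOp_annealCircuit (fun i => costTerm_isHermitian x part i X)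
        (hHM ω).isHermitian β γ)
  · have h1 := MeasureTheory.ae_of_ae_map measurable_fst.aemeasurable
      (hμ.map_fst.symm ▸ ae_degreeLE_sparseDisorder (fun j => pauli (x j)) s 𝔡)
    have h2 := MeasureTheory.ae_of_ae_map measurable_snd.aemeasurable
      (hμ.map_snd.symm ▸ ae_degreeLE_sparseDisorder (fun j => pauli (x j)) s 𝔡)
    -- Failure probability zero: the bound holds wherever both instances have bounded degree, for
    -- every `ω`.
    refine le_of_eq_of_le (MeasureTheory.ae_iff.1 ?_) zero_le
    filter_upwards [MeasureTheory.Measure.quasiMeasurePreserving_fst.ae h1,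
      MeasureTheory.Measure.quasiMeasurePreserving_fst.ae h2] with z hz1 hz2
    exact wassersteinNorm_annealing_sub_le hZ hlocal hc hHM hψ₀ β γ hz1 hz2 z.2
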